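/- All graphs are finite and loopless, but may have multiple edges; they need not be connected. For a graph $G$ and $X\subseteq V(G)$ let $\partial_G(X)$ be the set of edges of $G$ with one end in $X$ and the other in $V(G)\setminus X$; it is called a $k$-edge-cut if $|\partial_G(X)|=k$. A graph is bridgeless if it has no $1$-edge-cut. For an orientation $D$ of the edges of $G$ and a vertex $v$, let $\partial_D^+(v)$ and $\partial_D^-(v)$ be the sets of arcs with tail $v$ and with head $v$, respectively. $D$ is a modulo $3$-orientation of $G$ if $|\partial_D^+(v)|-|\partial_D^-(v)|\equiv 0 \pmod 3$ for every $v\in V(G)$. A nowhere-zero $3$-flow of $G$ is a pair $(D,f)$ of an orientation $D$ and a function $f:E(G)\to\{\pm1,\pm2\}$ with $\sum_{e\in\partial_D^+(v)}f(e)=\sum_{e\in\partial_D^-(v)}f(e)$ for every $v\in V(G)$. **Theorem 1.12.** Let $G$ be a bridgeless graph, and let $P=\{C=\partial_G(X): |C|=3,\ X\subseteq V(G)\}$ and $Q=\{C=\partial_G(X): |C|=5,\ X\subseteq V(G)\}$. If $2|P|+|Q|\le 7$, then $G$ has a modulo $3$-orientation, and therefore has a nowhere-zero $3$-flow. -/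

import Mathlib

open scoped Graph

namespace Graph

universe u v

/-- `∂_G(X, Y)`: the set of edges of `G` with one end in `X` and the other end in `Y`. -/
def edgesBetween {α : Type u} {β : Type v} (G : Graph α β) (X Y : Set α) : Set β :=
  {e | ∃ x ∈ X, ∃ y ∈ Y, G.IsLink e x y}

/-- `∂_G(X) = ∂_G(X, V(G) \ X)`: the edge-cut of `G` associated with `X`. -/
def edgeCut {α : Type u} {β : Type v} (G : Graph α β) (X : Set α) : Set β :=
  G.edgesBetween X (V(G) \ X)

/-- The set of all `k`-edge-cuts of `G`. Its members are sets of edges, so that two vertex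
sets (such as `X` and its complement) which have the same edge-cut are counted once. -/
def kEdgeCuts {α : Type u} {β : Type v} (G : Graph α β) (k : ℕ) : Set (Set β) :=
  {C | ∃ X : Set α, X ⊆ V(G) ∧ C = G.edgeCut X ∧ C.encard = k}

/-- The edge `e` is a bridge (or cut-edge) of `G`: it forms an edge-cut by itself. -/
def IsBridge {α : Type u} {β : Type v} (G : Graph α β) (e : β) : Prop :=
  ∃ X : Set α, X ⊆ V(G) ∧ G.edgeCut X = {e}

/-- `G` has no bridge. (It is not required to be connected.) -/
def Bridgeless {α : Type u} {β : Type v} (G : Graph α β) : Prop :=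
  ∀ e : β, ¬ G.IsBridge e

/-- An orientation of `G`: every edge is given a tail and a head, which are its two ends. -/
structure Orientation {α : Type u} {β : Type v} (G : Graph α β) where
  /-- The tail of the arc. -/
  tail : E(G) → α
  /-- The head of the arc. -/
  head : E(G) → α
  /-- The tail and the head of an arc are the ends of the underlying edge. -/
  isLink : ∀ e : E(G), G.IsLink (e : β) (tail e) (head e)

namespace Orientation

/-- `∂_D⁺(v)`: the arcs with tail `v`. -/
def outArcs {α : Type u} {β : Type v} {G : Graph α β} (D : G.Orientation) (x : α) : Set E(G) :=
  {e | D.tail e = x}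

/-- `∂_D⁻(v)`: the arcs with head `v`. -/
def inArcs {α : Type u} {β : Type v} {G : Graph α β} (D : G.Orientation) (x : α) : Set E(G) :=
  {e | D.head e = x}

/-- The out-degree `d_D⁺(v)` (for finite graphs). -/
noncomputable def outDegree {α : Type u} {β : Type v} {G : Graph α β} (D : G.Orientation)
    (x : α) : ℕ :=
  (D.outArcs x).ncard

/-- The in-degree `d_D⁻(v)` (for finite graphs). -/
noncomputable def inDegree {α : Type u} {β : Type v} {G : Graph α β} (D : G.Orientation)
    (x : α) : ℕ :=
  (D.inArcs x).ncard

/-- `D` is a modulo 3-orientation: `d_D⁺(v) - d_D⁻(v) ≡ 0 (mod 3)` for every vertex `v`. -/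
def IsModuloThree {α : Type u} {β : Type v} {G : Graph α β} (D : G.Orientation) : Prop :=
  ∀ x ∈ V(G), (D.outDegree x : ℤ) - (D.inDegree x : ℤ) ≡ 0 [ZMOD 3]

/-- `(D, f)` is a nowhere-zero 3-flow (for finite graphs): `f` takes values in `{±1, ±2}`, and
at every vertex the sum of `f` over the outgoing arcs equals the sum over the incoming arcs. -/
def IsNowhereZeroThreeFlow {α : Type u} {β : Type v} {G : Graph α β} (D : G.Orientation)
    (f : E(G) → ℤ) : Prop :=
  (∀ e : E(G), f e ∈ ({1, -1, 2, -2} : Set ℤ)) ∧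
    ∀ x ∈ V(G), ∑ᶠ e ∈ D.outArcs x, f e = ∑ᶠ e ∈ D.inArcs x, f e

end Orientation

end Graph

set_option linter.unusedSectionVars false

/-! Direct the edges arbitrarily; a modulo 3-orientation is then a choice of signs for which every
net outflow vanishes modulo 3. The engine is a rooted orientation theorem, `sol_of_inst`, of
Lovász–Thomassen–Wu–Zhang type. The arcs at a root `z` are fixed, and a boundary modulo 6 records
both a boundary modulo 3 and the parity of the degree. The root has degree at most 4 + `dist0` of
its boundary, while proper sets avoiding `z` have cuts of at least 4 + `dist0` of their total
boundary.

That theorem goes by induction. A tight cut around two or more vertices is treated by contracting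
its two sides in turn (`sol_of_tight`). Otherwise parity gives these cuts an excess of two, so only
single vertices obstruct local changes. A vertex of degree 4 and boundary 0 is split off
(`sol_of_degree_four`). An edge both of whose ends can spare it is deleted, so in a minimal
counterexample all non-root vertices are tight with boundary of one sign; an arc is then deleted at,
moved to or turned at the root (`sol_of_forall_isPlus`).

For the graph itself, cuts with 0 or 2 edges, and cuts with 3 edges and two vertices on each side,
are removed by contraction, which creates no new cuts. To what remains, a new root is attached with
two arcs entering it and at most five leaving it. The cut condition asks that each side of a 5-cut
receive a new arc, and each side of a 3-cut receive two, not just one of each direction. The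
hypothesis on the numbers of 3-cuts and 5-cuts is what makes seven new arcs suffice
(`balanced_of_three`, `balanced_of_no_three`).

Finally, the constant 1 on a modulo 3-orientation has net outflows divisible by 3. Switching values
between 1 and -2 along a path moves three units from its start to its end, and a path from surplus
to deficit always exists (`exists_less_imbalance`). -/

namespace ModThree

/-! ### Net outflow, cut degrees and rooted orientation problems -/

variable {V E : Type*} [DecidableEq V]

/-- The indicator of the tail minus the indicator of the head of an arc, on a vertex set. -/
def arcOn (R : Type*) [Ring R] (p : V × V) (A : Finset V) : R :=
  (if p.1 ∈ A then 1 else 0) - (if p.2 ∈ A then 1 else 0)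

/-- Whether an arc crosses a vertex set. -/
def crosses (p : V × V) (A : Finset V) : ℕ :=
  if (p.1 ∈ A ↔ p.2 ∈ A) then 0 else 1

/-- The net outflow of a vertex set. -/
def flux [Fintype E] {R : Type*} [Ring R] (g : E → V × V) (σ : E → R) (A : Finset V) : R :=
  ∑ e, σ e * arcOn R (g e) A

/-- The number of edges crossing a vertex set. -/
def cutDeg [Fintype E] (g : E → V × V) (A : Finset V) : ℕ :=
  ∑ e, crosses (g e) A

/-- The distance to zero in `ZMod 6`. -/
def dist0 (x : ZMod 6) : ℕ := min x.val (6 - x.val)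

/-- The arc is incident with the vertex. -/
def Meets (z : V) (p : V × V) : Prop := p.1 = z ∨ p.2 = z

section basic
variable [Fintype E] {R : Type*} [Ring R]

lemma sum_arcOn (p : V × V) (A : Finset V) :
    ∑ v ∈ A, arcOn R p {v} = arcOn R p A := by
  simp [arcOn, Finset.sum_sub_distrib, Finset.sum_ite_eq]

lemma sum_flux (g : E → V × V) (σ : E → R) (A : Finset V) :
    ∑ v ∈ A, flux g σ {v} = flux g σ A := by
  unfold flux
  rw [Finset.sum_comm]
  refine Finset.sum_congr rfl fun e _ => ?_
  rw [← Finset.mul_sum, sum_arcOn]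

lemma arcOn_swap (p : V × V) (A : Finset V) : arcOn R p.swap A = - arcOn R p A := by
  simp [arcOn]

lemma crosses_swap (p : V × V) (A : Finset V) : crosses p.swap A = crosses p A := by
  simp [crosses, iff_comm]

lemma crosses_le_one (p : V × V) (A : Finset V) : crosses p A ≤ 1 := by
  unfold crosses; split_ifs <;> simp

lemma arcOn_eq_zero {p : V × V} {A : Finset V} (h : crosses p A = 0) : arcOn R p A = 0 := by
  unfold crosses at h
  unfold arcOn
  split_ifs at h with h1
  by_cases h2 : p.1 ∈ A
  · simp [h2, h1.1 h2]
  · simp [h2, mt h1.2 h2]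

lemma crosses_cases (p : V × V) (A : Finset V) :
    crosses p A = 0 ∨ crosses p A = 1 ∧ (arcOn R p A = 1 ∨ arcOn R p A = -1) := by
  unfold crosses arcOn
  by_cases h1 : p.1 ∈ A <;> by_cases h2 : p.2 ∈ A <;> simp [h1, h2]

lemma three_mul_arcOn (p : V × V) (A : Finset V) :
    (3 : ZMod 6) * arcOn (ZMod 6) p A = 3 * (crosses p A : ZMod 6) := by
  unfold crosses arcOn
  by_cases h1 : p.1 ∈ A <;> by_cases h2 : p.2 ∈ A <;> simp [h1, h2]
  decide

lemma three_mul_flux (g : E → V × V) (A : Finset V) :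
    (3 : ZMod 6) * flux g 1 A = 3 * (cutDeg g A : ZMod 6) := by
  unfold flux cutDeg
  push_cast
  rw [Finset.mul_sum, Finset.mul_sum]
  refine Finset.sum_congr rfl fun e _ => ?_
  simp [three_mul_arcOn]

lemma arcOn_univ [Fintype V] (p : V × V) : arcOn R p Finset.univ = 0 := by
  simp [arcOn]

lemma flux_univ [Fintype V] (g : E → V × V) (σ : E → R) : flux g σ Finset.univ = 0 := by
  simp [flux, arcOn_univ]

lemma cutDeg_update [DecidableEq E] (g : E → V × V) (e : E) (p : V × V) (A : Finset V) :
    cutDeg (Function.update g e p) A + crosses (g e) A = cutDeg g A + crosses p A := by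
  unfold cutDeg
  rw [← Finset.add_sum_erase _ _ (Finset.mem_univ e),
    ← Finset.add_sum_erase _ (fun e => crosses (g e) A) (Finset.mem_univ e)]
  have : ∑ x ∈ Finset.univ.erase e, crosses (Function.update g e p x) A
      = ∑ x ∈ Finset.univ.erase e, crosses (g x) A :=
    Finset.sum_congr rfl fun x hx => by
      rw [Function.update_of_ne (Finset.ne_of_mem_erase hx)]
  rw [this]; simp only [Function.update_self]; ring

lemma flux_update [DecidableEq E] (g : E → V × V) (e : E) (p : V × V) (A : Finset V) :
    flux (Function.update g e p) (1 : E → R) A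
      = flux g 1 A - arcOn R (g e) A + arcOn R p A := by
  unfold flux
  rw [← Finset.add_sum_erase _ _ (Finset.mem_univ e),
    ← Finset.add_sum_erase _ (fun e => (1 : E → R) e * arcOn R (g e) A) (Finset.mem_univ e)]
  have : ∑ x ∈ Finset.univ.erase e, (1 : E → R) x * arcOn R (Function.update g e p x) A
      = ∑ x ∈ Finset.univ.erase e, (1 : E → R) x * arcOn R (g x) A :=
    Finset.sum_congr rfl fun x hx => by
      rw [Function.update_of_ne (Finset.ne_of_mem_erase hx)]
  rw [this]; simp only [Function.update_self, Pi.one_apply, one_mul]; abel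

lemma exists_crosses_of_cutDeg_pos {g : E → V × V} {A : Finset V} (h : 0 < cutDeg g A) :
    ∃ e, crosses (g e) A = 1 := by
  by_contra! hc
  have : cutDeg g A = 0 := Finset.sum_eq_zero fun e _ => by
    have := hc e
    have := crosses_le_one (g e) A
    omega
  omega

end basic

lemma dist0_neg (x : ZMod 6) : dist0 (-x) = dist0 x := by revert x; decide
lemma dist0_add_one (x : ZMod 6) : dist0 (x + 1) ≤ dist0 x + 1 := by revert x; decide
lemma dist0_sub_one (x : ZMod 6) : dist0 (x - 1) ≤ dist0 x + 1 := by revert x; decide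
lemma dist0_le_three (x : ZMod 6) : dist0 x ≤ 3 := by revert x; decide

/-- The hypothesis `hp` says that `B` and `d` have the same parity, and `dist0 B` shares it. The
excess of `d` over 4 + `dist0 B` is therefore even. -/
lemma slack_of_ne {B : ZMod 6} {d : ℕ} (hp : 3 * B = 3 * (d : ZMod 6)) (h : 4 + dist0 B ≤ d)
    (hne : d ≠ 4 + dist0 B) : 6 + dist0 B ≤ d := by
  by_contra hc
  have hd : d = 5 + dist0 B := by omega
  rw [hd] at hp
  have key : ∀ B : ZMod 6, 3 * B ≠ 3 * ((5 + dist0 B : ℕ) : ZMod 6) := by decide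
  exact key B hp

/-- The alternatives say whether a vertex can spare an outgoing arc, an incoming arc, both or
neither. A tight vertex with `B = 3` falls under both, since either neighbour of 3 is closer to
zero. -/
lemma vertex_type {B : ZMod 6} {d : ℕ} (hp : 3 * B = 3 * (d : ZMod 6)) (h : 4 + dist0 B ≤ d) :
    (5 + dist0 (B - 1) ≤ d ∧ 5 + dist0 (B + 1) ≤ d) ∨ (B = 1 ∧ d = 5 ∨ B = 2 ∧ d = 6) ∨
      (B = 5 ∧ d = 5 ∨ B = 4 ∧ d = 6) ∨ (B = 0 ∧ d = 4) := by
  by_cases hd : d = 4 + dist0 B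
  · subst hd; clear hp h; revert B; decide
  · have := slack_of_ne hp h hd
    have := dist0_add_one B
    have := dist0_sub_one B
    left; omega

/-- A rooted orientation problem: at the root `z` all arcs are fixed, the other arcs may be
reversed, and `b` is the prescribed boundary modulo 6. -/
structure Inst [Fintype V] [Fintype E] (U : Finset V) (z : V) (g : E → V × V)
    (b : V → ZMod 6) : Prop where
  root_mem : z ∈ U
  ends : ∀ e, (g e).1 ∈ U ∧ (g e).2 ∈ U
  supp : ∀ v, v ∉ U → b v = 0
  sum : ∑ v, b v = 0
  par : ∀ v, 3 * b v = 3 * flux g 1 {v}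
  root : b z = flux g 1 {z}
  rootDeg : cutDeg g {z} ≤ 4 + dist0 (b z)
  cut : ∀ A ⊆ U.erase z, A.Nonempty → A ≠ U.erase z → 4 + dist0 (∑ v ∈ A, b v) ≤ cutDeg g A

/-- The rooted orientation problem has a solution. -/
def Sol [Fintype E] (z : V) (g : E → V × V) (b : V → ZMod 6) : Prop :=
  ∃ σ : E → ZMod 6, (∀ e, σ e = 1 ∨ σ e = -1) ∧ (∀ e, Meets z (g e) → σ e = 1) ∧
    ∀ v, flux g σ {v} = b v

/-- The weight of an arc in the induction measure. -/
def arcWeight (z : V) (p : V × V) : ℕ :=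
  if p.1 = p.2 then 0 else if p.1 = z ∨ p.2 = z then 1 else 2

/-- The induction measure. -/
def size [Fintype E] (U : Finset V) (z : V) (g : E → V × V) : ℕ :=
  U.card + ∑ e, arcWeight z (g e)

section inst
variable [Fintype V] [Fintype E] {U : Finset V} {z : V} {g : E → V × V} {b : V → ZMod 6}

lemma Inst.par_sum (h : Inst U z g b) (A : Finset V) :
    3 * ∑ v ∈ A, b v = 3 * (cutDeg g A : ZMod 6) := by
  rw [← three_mul_flux, ← sum_flux, Finset.mul_sum, Finset.mul_sum]
  exact Finset.sum_congr rfl fun v _ => h.par v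

/-- The boundary prescribed after replacing the arcs `g` by `g'`. -/
def shiftBdry (g g' : E → V × V) (b : V → ZMod 6) (v : V) : ZMod 6 :=
  b v + flux g' 1 {v} - flux g 1 {v}

lemma sum_shiftBdry (g g' : E → V × V) (b : V → ZMod 6) (A : Finset V) :
    ∑ v ∈ A, shiftBdry g g' b v = ∑ v ∈ A, b v + flux g' 1 A - flux g 1 A := by
  simp [shiftBdry, Finset.sum_sub_distrib, Finset.sum_add_distrib, sum_flux]

lemma flux_eq_zero_of_ends {R : Type*} [Ring R] {g : E → V × V}
    (h : ∀ e, (g e).1 ∈ U ∧ (g e).2 ∈ U) (σ : E → R)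
    {v : V} (hv : v ∉ U) : flux g σ {v} = 0 := by
  refine Finset.sum_eq_zero fun e _ => ?_
  have h1 : (g e).1 ≠ v := fun h' => hv (h' ▸ (h e).1)
  have h2 : (g e).2 ≠ v := fun h' => hv (h' ▸ (h e).2)
  simp [arcOn, h1, h2]

lemma Inst.replace (h : Inst U z g b) {g' : E → V × V}
    (he : ∀ e, (g' e).1 ∈ U ∧ (g' e).2 ∈ U)
    (hr : cutDeg g' {z} ≤ 4 + dist0 (b z + flux g' 1 {z} - flux g 1 {z}))
    (hc : ∀ A ⊆ U.erase z, A.Nonempty → A ≠ U.erase z →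
      4 + dist0 (∑ v ∈ A, b v + flux g' 1 A - flux g 1 A) ≤ cutDeg g' A) :
    Inst U z g' (shiftBdry g g' b) where
  root_mem := h.root_mem
  ends := he
  supp v hv := by
    simp [shiftBdry, h.supp v hv, flux_eq_zero_of_ends he _ hv, flux_eq_zero_of_ends h.ends _ hv]
  sum := by rw [sum_shiftBdry, h.sum, flux_univ, flux_univ]; simp
  par v := by
    have := h.par v
    unfold shiftBdry; linear_combination this
  root := by simp [shiftBdry, h.root]
  rootDeg := hr
  cut A h1 h2 h3 := by rw [sum_shiftBdry]; exact hc A h1 h2 h3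

/-- A replaced arc meets the root, so its sign is 1 in any solution for `g'`. It thus keeps its
direction in `g`, and `shiftBdry` accounts for the difference of the two fixed contributions. -/
lemma Sol.of_replace {g' : E → V × V} (hg : ∀ e, g' e = g e ∨ Meets z (g' e))
    (h : Sol z g' (shiftBdry g g' b)) : Sol z g b := by
  obtain ⟨σ, h1, h2, h3⟩ := h
  refine ⟨σ, h1, fun e he => ?_, fun v => ?_⟩
  · rcases hg e with h' | h'
    · exact h2 e (h' ▸ he)
    · exact h2 e h'
  · have := h3 v
    have key : flux g' σ {v} - flux g' 1 {v} = flux g σ {v} - flux g 1 {v} := by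
      unfold flux
      rw [← Finset.sum_sub_distrib, ← Finset.sum_sub_distrib]
      refine Finset.sum_congr rfl fun e _ => ?_
      rcases hg e with h' | h'
      · rw [h']
      · simp [h2 e h']
    unfold shiftBdry at this
    linear_combination this - key

/-- Reverse the arcs where `ε` is `false`. -/
def flipArcs (g : E → V × V) (ε : E → Bool) (e : E) : V × V :=
  if ε e then g e else (g e).swap

lemma cutDeg_flipArcs (g : E → V × V) (ε : E → Bool) (A : Finset V) :
    cutDeg (flipArcs g ε) A = cutDeg g A :=
  Finset.sum_congr rfl fun e _ => by
    unfold flipArcs; split_ifs <;> simp [crosses_swap]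

lemma meets_swap (p : V × V) : Meets z p.swap ↔ Meets z p := by
  simp [Meets, or_comm]

lemma arcWeight_swap (p : V × V) : arcWeight z p.swap = arcWeight z p := by
  simp [arcWeight, or_comm, eq_comm]

lemma size_flipArcs (g : E → V × V) (ε : E → Bool) : size U z (flipArcs g ε) = size U z g := by
  unfold size
  congr 1
  refine Finset.sum_congr rfl fun e _ => ?_
  unfold flipArcs; split_ifs <;> simp [arcWeight_swap]

/-- The sign of an arc after reversal. -/
def boolSign (t : Bool) : ZMod 6 := if t then 1 else -1

lemma flux_flipArcs (g : E → V × V) (ε : E → Bool) (σ : E → ZMod 6) (A : Finset V) :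
    flux (flipArcs g ε) σ A = flux g (fun e => boolSign (ε e) * σ e) A := by
  refine Finset.sum_congr rfl fun e _ => ?_
  cases h : ε e <;> simp [flipArcs, boolSign, arcOn_swap, h]

/-- Only arcs at the root have a meaningful direction; the others may be redirected at will because
both signs are allowed. -/
lemma Inst.flip (h : Inst U z g b) {ε : E → Bool} (hε : ∀ e, Meets z (g e) → ε e = true) :
    Inst U z (flipArcs g ε) b where
  root_mem := h.root_mem
  ends e := by
    have := h.ends e
    unfold flipArcs; split_ifs
    · exact this
    · exact this.symm
  supp := h.supp
  sum := h.sum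
  par v := by rw [three_mul_flux, cutDeg_flipArcs, ← three_mul_flux, h.par]
  root := by
    rw [h.root, flux_flipArcs]
    refine Finset.sum_congr rfl fun e _ => ?_
    by_cases hm : Meets z (g e)
    · simp [hε e hm, boolSign]
    · unfold Meets at hm
      push Not at hm
      simp [arcOn, hm.1, hm.2]
  rootDeg := by rw [cutDeg_flipArcs]; exact h.rootDeg
  cut := by simpa only [cutDeg_flipArcs] using h.cut

lemma Sol.of_flip {ε : E → Bool} (hε : ∀ e, Meets z (g e) → ε e = true)
    (h : Sol z (flipArcs g ε) b) : Sol z g b := by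
  obtain ⟨σ, h1, h2, h3⟩ := h
  refine ⟨fun e => boolSign (ε e) * σ e, fun e => ?_, fun e he => ?_, fun v => ?_⟩
  · rcases h1 e with h | h <;> cases h' : ε e <;> simp [boolSign, h, h']
  · have : flipArcs g ε e = g e := by simp [flipArcs, hε e he]
    simp [hε e he, boolSign, h2 e (this ▸ he)]
  · rw [← flux_flipArcs]; exact h3 v

lemma flux_swap {R : Type*} [Ring R] (g : E → V × V) (σ : E → R) (A : Finset V) :
    flux (fun e => (g e).swap) σ A = - flux g σ A := by
  simp [flux, arcOn_swap]

lemma cutDeg_swap (g : E → V × V) (A : Finset V) :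
    cutDeg (fun e => (g e).swap) A = cutDeg g A := by
  simp [cutDeg, crosses_swap]

lemma Inst.reverse (h : Inst U z g b) : Inst U z (fun e => (g e).swap) (fun v => -b v) where
  root_mem := h.root_mem
  ends e := (h.ends e).symm
  supp v hv := by simp [h.supp v hv]
  sum := by simp [h.sum]
  par v := by rw [flux_swap, mul_neg, mul_neg, h.par]
  root := by simp [flux_swap, h.root]
  rootDeg := by simpa only [cutDeg_swap, dist0_neg] using h.rootDeg
  cut A h1 h2 h3 := by
    rw [cutDeg_swap, Finset.sum_neg_distrib, dist0_neg]; exact h.cut A h1 h2 h3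

lemma Sol.of_reverse (h : Sol z (fun e => (g e).swap) (fun v => -b v)) : Sol z g b := by
  obtain ⟨σ, h1, h2, h3⟩ := h
  refine ⟨σ, h1, fun e he => h2 e ((meets_swap _).2 he), fun v => ?_⟩
  have := h3 v
  rw [flux_swap] at this
  exact neg_injective this

lemma size_swap (g : E → V × V) : size U z (fun e => (g e).swap) = size U z g := by
  simp [size, arcWeight_swap]

end inst

end ModThree

namespace ModThree

/-! ### Local reductions: deleting, moving and turning arcs -/

variable {V E : Type*} [DecidableEq V] [Fintype V] [Fintype E] [DecidableEq E]
  {U : Finset V} {z : V} {g : E → V × V} {b : V → ZMod 6}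

lemma size_update (U : Finset V) (z : V) (g : E → V × V) (e : E) (p : V × V) :
    size U z (Function.update g e p) + arcWeight z (g e) = size U z g + arcWeight z p := by
  unfold size
  rw [← Finset.add_sum_erase _ _ (Finset.mem_univ e),
    ← Finset.add_sum_erase _ (fun e => arcWeight z (g e)) (Finset.mem_univ e)]
  have : ∑ x ∈ Finset.univ.erase e, arcWeight z (Function.update g e p x)
      = ∑ x ∈ Finset.univ.erase e, arcWeight z (g x) :=
    Finset.sum_congr rfl fun x hx => by
      rw [Function.update_of_ne (Finset.ne_of_mem_erase hx)]
  rw [this]; simp only [Function.update_self]; ring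

/-- All problems of smaller size are solvable. -/
def SmallerSolvable (U : Finset V) (z : V) (g : E → V × V) : Prop :=
  ∀ (U' : Finset V) (g' : E → V × V) (b' : V → ZMod 6),
    size U' z g' < size U z g → Inst U' z g' b' → Sol z g' b'

/-- Non-trivial cuts have excess. -/
def Slack (U : Finset V) (z : V) (g : E → V × V) (b : V → ZMod 6) : Prop :=
  ∀ A ⊆ U.erase z, 2 ≤ A.card → A ≠ U.erase z → 6 + dist0 (∑ v ∈ A, b v) ≤ cutDeg g A

lemma Slack.singleton_or (hs : Slack U z g b) {A : Finset V} (h1 : A ⊆ U.erase z)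
    (h2 : A.Nonempty) (h3 : A ≠ U.erase z) :
    (∃ v, A = {v}) ∨ 6 + dist0 (∑ v ∈ A, b v) ≤ cutDeg g A := by
  by_cases h : A.card = 1
  · exact Or.inl (Finset.card_eq_one.1 h)
  · have := h2.card_pos
    exact Or.inr (hs A h1 (by omega) h3)

lemma ends_update (h : Inst U z g b) (e : E) {p : V × V} (hp : p.1 ∈ U ∧ p.2 ∈ U) (e' : E) :
    (Function.update g e p e').1 ∈ U ∧ (Function.update g e p e').2 ∈ U := by
  by_cases he : e' = e
  · subst he; simpa using hp
  · simpa [he] using h.ends e'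

/-- Deletion means replacing the arc by a loop at the root, which keeps the edge type and has weight
0. Larger cuts are protected by `Slack`, so only `x` and `y` need a hypothesis. If an end is the
root, its degree drops by one and its `dist0` by at most one, so no hypothesis is needed there. -/
lemma sol_of_delete (h : Inst U z g b) (hs : Slack U z g b) (ih : SmallerSolvable U z g)
    {e : E} {x y : V} (hg : g e = (x, y)) (hxy : x ≠ y)
    (hx : x ≠ z → 5 + dist0 (b x - 1) ≤ cutDeg g {x})
    (hy : y ≠ z → 5 + dist0 (b y + 1) ≤ cutDeg g {y}) : Sol z g b := by
  have hz := h.root_mem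
  refine Sol.of_replace (g' := Function.update g e (z, z)) (fun e' => ?_)
    (ih U _ _ ?_ (h.replace (ends_update h e ⟨hz, hz⟩) ?_ ?_))
  · by_cases he : e' = e
    · subst he; simp [Meets]
    · simp [he]
  · have := size_update U z g e (z, z)
    have h1 : 0 < arcWeight z (g e) := by
      unfold arcWeight; rw [hg]; simp only [hxy, if_false]; split_ifs <;> simp
    have h2 : arcWeight z (z, z) = 0 := by simp [arcWeight]
    omega
  · have h1 := cutDeg_update g e (z, z) {z}
    rw [flux_update, hg]
    rw [hg] at h1
    have h2 := h.rootDeg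
    have h3 := dist0_add_one (b z - 1)
    have h4 := dist0_sub_one (b z + 1)
    simp only [sub_add_cancel, add_sub_cancel_right] at h3 h4
    by_cases h5 : x = z <;> by_cases h6 : y = z
    · exact absurd (h5.trans h6.symm) hxy
    · simp [arcOn, crosses, h5, h6] at h1 ⊢
      ring_nf at h3 h4 ⊢
      omega
    · simp [arcOn, crosses, h5, h6] at h1 ⊢
      ring_nf at h3 h4 ⊢
      omega
    · simp [arcOn, crosses, h5, h6] at h1 ⊢
      ring_nf at h3 h4 ⊢
      omega
  · intro A hA1 hA2 hA3
    have h1 := cutDeg_update g e (z, z) A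
    rw [flux_update, hg]
    rw [hg] at h1
    have h2 := h.cut A hA1 hA2 hA3
    have hs' := hs.singleton_or hA1 hA2 hA3
    have hzA : z ∉ A := fun hz => Finset.notMem_erase z U (hA1 hz)
    have hne : ∀ v ∈ A, v ≠ z := fun v hv h => hzA (h ▸ hv)
    have h3 := dist0_add_one (∑ v ∈ A, b v)
    have h4 := dist0_sub_one (∑ v ∈ A, b v)
    by_cases h5 : x ∈ A <;> by_cases h6 : y ∈ A
    · simp [arcOn, crosses, h5, h6, hzA] at h1 ⊢
      omega
    · have hx' := hx (hne x h5)
      simp [arcOn, crosses, h5, h6, hzA] at h1 ⊢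
      have : ∑ v ∈ A, b v + (flux g 1 A - 1) - flux g 1 A = ∑ v ∈ A, b v - 1 := by ring
      rw [this]
      rcases hs' with ⟨v, rfl⟩ | hs'
      · obtain rfl := Finset.mem_singleton.1 h5
        simp at *
        omega
      · omega
    · have hy' := hy (hne y h6)
      simp [arcOn, crosses, h5, h6, hzA] at h1 ⊢
      have : ∑ v ∈ A, b v + (flux g 1 A + 1) - flux g 1 A = ∑ v ∈ A, b v + 1 := by ring
      rw [this]
      rcases hs' with ⟨v, rfl⟩ | hs'
      · obtain rfl := Finset.mem_singleton.1 h6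
        simp at *
        omega
      · omega
    · simp [arcOn, crosses, h5, h6, hzA] at h1 ⊢
      omega

/-- Move the tail of an arc `(x, y)` to the root. -/
lemma sol_of_move (h : Inst U z g b) (hs : Slack U z g b) (ih : SmallerSolvable U z g)
    {e : E} {x y : V} (hg : g e = (x, y)) (hxy : x ≠ y) (hxz : x ≠ z) (hyz : y ≠ z)
    (hx : 5 + dist0 (b x - 1) ≤ cutDeg g {x})
    (hr : cutDeg g {z} + 1 ≤ 4 + dist0 (b z + 1)) : Sol z g b := by
  have hz := h.root_mem
  have hyU : y ∈ U := by have := (h.ends e).2; rwa [hg] at this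
  refine Sol.of_replace (g' := Function.update g e (z, y)) (fun e' => ?_)
    (ih U _ _ ?_ (h.replace (ends_update h e ⟨hz, hyU⟩) ?_ ?_))
  · by_cases he : e' = e
    · subst he; simp [Meets]
    · simp [he]
  · have := size_update U z g e (z, y)
    have h1 : arcWeight z (g e) = 2 := by
      simp [arcWeight, hg, hxy, hxz, hyz]
    have h2 : arcWeight z (z, y) ≤ 1 := by
      unfold arcWeight; split_ifs <;> simp_all
    omega
  · have h1 := cutDeg_update g e (z, y) {z}
    rw [flux_update, hg]
    rw [hg] at h1
    simp [arcOn, crosses, hxz, hyz] at h1 ⊢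
    have : b z + (flux g 1 {z} + 1) - flux g 1 {z} = b z + 1 := by ring
    rw [this]; omega
  · intro A hA1 hA2 hA3
    have h1 := cutDeg_update g e (z, y) A
    rw [flux_update, hg]
    rw [hg] at h1
    have h2 := h.cut A hA1 hA2 hA3
    have hs' := hs.singleton_or hA1 hA2 hA3
    have hzA : z ∉ A := fun hz => Finset.notMem_erase z U (hA1 hz)
    have h3 := dist0_add_one (∑ v ∈ A, b v)
    have h4 := dist0_sub_one (∑ v ∈ A, b v)
    by_cases h5 : x ∈ A
    · have key : ∑ v ∈ A, b v + (flux g 1 A - 1) - flux g 1 A = ∑ v ∈ A, b v - 1 := by ring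
      by_cases h6 : y ∈ A
      · simp [arcOn, crosses, h5, h6, hzA] at h1 ⊢
        rw [← sub_eq_add_neg, key]; omega
      · simp [arcOn, crosses, h5, h6, hzA] at h1 ⊢
        rw [key]
        rcases hs' with ⟨v, rfl⟩ | hs'
        · obtain rfl := Finset.mem_singleton.1 h5
          simp at *
          omega
        · omega
    · by_cases h6 : y ∈ A
      · simp [arcOn, crosses, h5, h6, hzA] at h1 ⊢
        omega
      · simp [arcOn, crosses, h5, h6, hzA] at h1 ⊢
        omega

/-- Replace arcs `(z, x)` and `(y, x)` by two arcs `(x, z)`. -/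
lemma sol_of_turn (h : Inst U z g b) (hs : Slack U z g b) (ih : SmallerSolvable U z g)
    {e e' : E} {x y : V} (hg : g e = (z, x)) (hg' : g e' = (y, x)) (hxy : x ≠ y) (hxz : x ≠ z)
    (hyz : y ≠ z)
    (hx : 4 + dist0 (b x + 4) ≤ cutDeg g {x})
    (hy : 5 + dist0 (b y - 1) ≤ cutDeg g {y})
    (hr : cutDeg g {z} + 1 ≤ 4 + dist0 (b z - 3)) : Sol z g b := by
  have hz := h.root_mem
  have hxU : x ∈ U := by have := (h.ends e).2; rwa [hg] at this
  have hee : e' ≠ e := by rintro rfl; rw [hg] at hg'; simp_all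
  obtain ⟨g₁, hg₁⟩ : ∃ g₁, g₁ = Function.update g e (x, z) := ⟨_, rfl⟩
  have hg₁e : g₁ e' = (y, x) := by simp [hg₁, hee, hg']
  have hends : ∀ e'', (g₁ e'').1 ∈ U ∧ (g₁ e'').2 ∈ U := hg₁ ▸ ends_update h e ⟨hxU, hz⟩
  refine Sol.of_replace (g' := Function.update g₁ e' (x, z)) (fun e'' => ?_)
    (ih U _ _ ?_ (h.replace ?_ ?_ ?_))
  · by_cases he : e'' = e'
    · subst he; simp [Meets]
    · by_cases he' : e'' = e
      · subst he'; simp [hg₁, he, Meets]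
      · simp [hg₁, he, he']
  · have h0 := size_update U z g e (x, z)
    rw [← hg₁] at h0
    have h0' := size_update U z g₁ e' (x, z)
    have h1 : arcWeight z (g₁ e') = 2 := by
      simp [arcWeight, hg₁e, hxy.symm, hxz, hyz]
    have h3 : arcWeight z (g e) = 1 := by
      simp [arcWeight, hg, hxz.symm]
    have h2 : arcWeight z (x, z) = 1 := by simp [arcWeight, hxz]
    omega
  · intro e''
    by_cases he : e'' = e'
    · subst he; simpa using ⟨hxU, hz⟩
    · simpa [he] using hends e''
  · have h0 := cutDeg_update g e (x, z) {z}
    have h1 := cutDeg_update g₁ e' (x, z) {z}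
    have f0 := flux_update (R := ZMod 6) g e (x, z) {z}
    rw [← hg₁, hg] at f0 h0
    rw [hg₁e] at h1
    rw [flux_update, hg₁e, f0]
    clear f0
    simp [arcOn, crosses, hxz, hyz] at h0 h1 ⊢
    have : b z + (flux g 1 {z} - 1 + -1 + -1) - flux g 1 {z} = b z - 3 := by ring
    rw [this]; omega
  · intro A hA1 hA2 hA3
    have h0 := cutDeg_update g e (x, z) A
    have h1 := cutDeg_update g₁ e' (x, z) A
    have f0 := flux_update (R := ZMod 6) g e (x, z) A
    rw [← hg₁, hg] at f0 h0
    rw [hg₁e] at h1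
    rw [flux_update, hg₁e, f0]
    clear f0
    have h2 := h.cut A hA1 hA2 hA3
    have hs' := hs.singleton_or hA1 hA2 hA3
    have hzA : z ∉ A := fun hz => Finset.notMem_erase z U (hA1 hz)
    have h3 := dist0_add_one (∑ v ∈ A, b v)
    have h4 := dist0_sub_one (∑ v ∈ A, b v)
    by_cases h5 : x ∈ A
    · by_cases h6 : y ∈ A
      · rcases hs' with ⟨v, rfl⟩ | hs'
        · simp at h5 h6
          exact absurd (h5.trans h6.symm) hxy
        -- The cut gains one edge and so has at least 7 = 4 + 3 edges, enough for any boundary.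
        · have := dist0_le_three
            (∑ v ∈ A, b v + (flux g 1 A + 1 + 1 + 1) - flux g 1 A)
          simp [arcOn, crosses, h5, h6, hzA] at h0 h1 ⊢
          omega
      · simp [arcOn, crosses, h5, h6, hzA] at h0 h1 ⊢
        have key : ∑ v ∈ A, b v + (flux g 1 A + 1 + 1 + 1 + 1) - flux g 1 A
          = ∑ v ∈ A, b v + 4 := by ring
        rw [key]
        rcases hs' with ⟨v, rfl⟩ | hs'
        · obtain rfl := Finset.mem_singleton.1 h5
          simp at *
          omega
        -- The size of the cut is unchanged; its slack of two absorbs the shift of 4, that is -2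
        -- modulo 6.
        · have : ∀ B : ZMod 6, dist0 (B + 4) ≤ dist0 B + 2 := by decide
          have := this (∑ v ∈ A, b v)
          omega
    · by_cases h6 : y ∈ A
      · simp [arcOn, crosses, h5, h6, hzA] at h0 h1 ⊢
        have key : ∑ v ∈ A, b v + (flux g 1 A - 1) - flux g 1 A = ∑ v ∈ A, b v - 1 := by ring
        rw [key]
        rcases hs' with ⟨v, rfl⟩ | hs'
        · obtain rfl := Finset.mem_singleton.1 h6
          simp at *
          omega
        · omega
      · simp [arcOn, crosses, h5, h6, hzA] at h0 h1 ⊢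
        omega

end ModThree

namespace ModThree

/-! ### Contraction and tight cuts -/

variable {V E : Type*} [DecidableEq V] [Fintype V] [Fintype E]
  {U : Finset V} {z : V} {g : E → V × V} {b : V → ZMod 6}

/-- Identify vertices along a map. -/
def mapArcs (f : V → V) (g : E → V × V) (e : E) : V × V := (f (g e).1, f (g e).2)

/-- The preimage of a vertex set. -/
def pre (f : V → V) (A : Finset V) : Finset V := Finset.univ.filter (f · ∈ A)

/-- Push a boundary forward along a map. -/
def push {R : Type*} [AddCommMonoid R] (f : V → V) (b : V → R) (v : V) : R :=
  ∑ u ∈ pre f {v}, b u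

@[simp] lemma mem_pre {f : V → V} {A : Finset V} {v : V} : v ∈ pre f A ↔ f v ∈ A := by
  simp [pre]

lemma flux_mapArcs {R : Type*} [Ring R] (f : V → V) (g : E → V × V) (σ : E → R) (A : Finset V) :
    flux (mapArcs f g) σ A = flux g σ (pre f A) := by
  refine Finset.sum_congr rfl fun e _ => ?_
  by_cases h1 : f (g e).1 ∈ A <;> by_cases h2 : f (g e).2 ∈ A <;>
    simp [arcOn, mapArcs, h1, h2]

lemma cutDeg_mapArcs (f : V → V) (g : E → V × V) (A : Finset V) :
    cutDeg (mapArcs f g) A = cutDeg g (pre f A) := by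
  refine Finset.sum_congr rfl fun e _ => ?_
  by_cases h1 : f (g e).1 ∈ A <;> by_cases h2 : f (g e).2 ∈ A <;>
    simp [crosses, mapArcs, h1, h2]

lemma sum_push {R : Type*} [AddCommMonoid R] (f : V → V) (b : V → R) (A : Finset V) :
    ∑ v ∈ A, push f b v = ∑ u ∈ pre f A, b u := by
  unfold push
  rw [← Finset.sum_fiberwise_of_maps_to (g := f) (t := A) (fun u hu => mem_pre.1 hu)]
  refine Finset.sum_congr rfl fun v hv => Finset.sum_congr ?_ fun _ _ => rfl
  ext u
  simp only [mem_pre, Finset.mem_singleton, Finset.mem_filter]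
  exact ⟨fun h => ⟨h ▸ hv, h⟩, fun h => h.2⟩

lemma arcWeight_map_le {f : V → V} (hf : f z = z) (p : V × V) :
    arcWeight z (f p.1, f p.2) ≤ arcWeight z p := by
  unfold arcWeight
  split_ifs with h1 h2 h3 h4 h5 h6 <;> try simp_all
  rename_i h
  rcases h with h | h <;> simp_all

lemma sum_arcWeight_mapArcs_le {f : V → V} (hf : f z = z) (g : E → V × V) :
    ∑ e, arcWeight z (mapArcs f g e) ≤ ∑ e, arcWeight z (g e) :=
  Finset.sum_le_sum fun e _ => arcWeight_map_le hf (g e)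

/-- Cuts and boundaries of the image are those of preimages, so all conditions are inherited
provided nothing else is merged into the root. -/
lemma Inst.map (h : Inst U z g b) {f : V → V} (hz : ∀ v, f v = z ↔ v = z)
    (hU : ∀ v ∈ U, f v ∈ U) (hU' : ∀ v, v ∉ U → f v = v) :
    Inst (U.image f) z (mapArcs f g) (push f b) where
  root_mem := Finset.mem_image.2 ⟨z, h.root_mem, (hz z).2 rfl⟩
  ends e := ⟨Finset.mem_image_of_mem f (h.ends e).1, Finset.mem_image_of_mem f (h.ends e).2⟩
  supp v hv := Finset.sum_eq_zero fun u hu => by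
    refine h.supp u fun huU => hv ?_
    rw [mem_pre, Finset.mem_singleton] at hu
    exact hu ▸ Finset.mem_image_of_mem f huU
  sum := by
    rw [sum_push, ← h.sum]
    exact Finset.sum_congr (by ext; simp) fun _ _ => rfl
  par v := by
    rw [flux_mapArcs, three_mul_flux, ← h.par_sum]; rfl
  root := by
    have : pre f {z} = {z} := by ext v; simp [hz]
    rw [flux_mapArcs, push, this, Finset.sum_singleton, h.root]
  rootDeg := by
    have : pre f {z} = {z} := by ext v; simp [hz]
    rw [cutDeg_mapArcs, push, this, Finset.sum_singleton]
    exact h.rootDeg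
  cut A h1 h2 h3 := by
    rw [sum_push, cutDeg_mapArcs]
    refine h.cut _ (fun v hv => ?_) ?_ (fun hA => h3 ?_)
    · rw [mem_pre] at hv
      have := h1 hv
      rw [Finset.mem_erase, Finset.mem_image] at this
      obtain ⟨h4, w, hw, hwv⟩ := this
      refine Finset.mem_erase.2 ⟨fun h' => h4 ((hz v).2 h'), ?_⟩
      by_contra hvU
      exact hvU (hU' v hvU ▸ hwv ▸ hU w hw)
    · obtain ⟨v, hv⟩ := h2
      have := h1 hv
      rw [Finset.mem_erase, Finset.mem_image] at this
      obtain ⟨-, w, -, rfl⟩ := this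
      exact ⟨w, mem_pre.2 hv⟩
    · refine Finset.Subset.antisymm h1 fun v hv => ?_
      rw [Finset.mem_erase, Finset.mem_image] at hv
      obtain ⟨h4, w, hw, rfl⟩ := hv
      have : w ∈ pre f A := by
        rw [hA]; exact Finset.mem_erase.2 ⟨fun h' => h4 ((hz w).2 h'), hw⟩
      exact mem_pre.1 this

/-- Collapse a vertex set to one vertex. -/
def collapse (A : Finset V) (a : V) (v : V) : V := if v ∈ A then a else v

/-- Collapse everything outside a vertex set to one vertex. -/
def retract (A : Finset V) (z : V) (v : V) : V := if v ∈ A then v else z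

lemma pre_retract {A : Finset V} (hz : z ∉ A) {B : Finset V} (hB : B ⊆ A) :
    pre (retract A z) B = B := by
  ext v
  by_cases hv : v ∈ A
  · simp [retract, hv]
  · have h1 : v ∉ B := fun h => hv (hB h)
    have h2 : z ∉ B := fun h => hz (hB h)
    simp [retract, hv, h1, h2]

lemma pre_retract_root {A : Finset V} (hz : z ∉ A) : pre (retract A z) {z} = Aᶜ := by
  ext v
  by_cases hv : v ∈ A
  · simp only [retract, mem_pre, hv, if_true, Finset.mem_singleton, Finset.mem_compl]
    simp only [not_true, iff_false]
    rintro rfl; exact hz hv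
  · simp [retract, hv]

lemma pre_collapse_of_notMem {A : Finset V} {a v : V} (ha : a ∈ A) (hv : v ∉ A) :
    pre (collapse A a) {v} = {v} := by
  ext u
  by_cases hu : u ∈ A
  · simp only [collapse, mem_pre, hu, if_true, Finset.mem_singleton]
    constructor
    · rintro rfl; exact absurd ha hv
    · rintro rfl; exact absurd hu hv
  · simp [collapse, hu]

lemma pre_collapse_self {A : Finset V} {a : V} (ha : a ∈ A) :
    pre (collapse A a) {a} = A := by
  ext u
  by_cases hu : u ∈ A
  · simp [collapse, hu]
  · simp only [collapse, mem_pre, hu, if_false, Finset.mem_singleton, iff_false]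
    rintro rfl; exact hu ha

lemma crosses_compl (p : V × V) (A : Finset V) : crosses p Aᶜ = crosses p A := by
  simp [crosses, not_iff_not]

lemma cutDeg_compl (g : E → V × V) (A : Finset V) : cutDeg g Aᶜ = cutDeg g A := by
  simp [cutDeg, crosses_compl]

lemma card_image_collapse_lt {A : Finset V} {a : V} (hA : A ⊆ U) (h2 : 2 ≤ A.card) :
    (U.image (collapse A a)).card < U.card := by
  refine lt_of_le_of_ne Finset.card_image_le fun hc => ?_
  have hinj := Finset.card_image_iff.1 hc
  obtain ⟨x, hx, y, hy, hxy⟩ := Finset.one_lt_card.1 (show 1 < A.card by omega)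
  exact hxy (hinj (hA hx) (hA hy) (by simp [collapse, hx, hy]))

/-- The complement of `A` becomes the new root. Tightness of `A` is exactly the degree bound
required there, and `hb` says that the arcs across the cut already realise the boundary. -/
lemma Inst.retract (h : Inst U z g b) {A : Finset V} (hA : A ⊆ U.erase z) (hA' : A ≠ U.erase z)
    (htight : cutDeg g A = 4 + dist0 (∑ v ∈ A, b v)) (hb : flux g 1 A = ∑ v ∈ A, b v) :
    Inst (insert z A) z (mapArcs (retract A z) g) (push (retract A z) b) := by
  have hzA : z ∉ A := fun hz => Finset.notMem_erase z U (hA hz)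
  have hcompl : ∑ v ∈ Aᶜ, b v = - ∑ v ∈ A, b v := by
    rw [eq_neg_iff_add_eq_zero, Finset.sum_compl_add_sum, h.sum]
  have hfl : flux g 1 Aᶜ = - flux g (1 : E → ZMod 6) A := by
    rw [eq_neg_iff_add_eq_zero, ← sum_flux, ← sum_flux, Finset.sum_compl_add_sum, sum_flux,
      flux_univ]
  have hmem : ∀ v, ModThree.retract A z v ∈ insert z A := fun v => by
    by_cases hv : v ∈ A <;> simp [ModThree.retract, hv]
  have herase : (insert z A).erase z = A := Finset.erase_insert hzA
  refine ⟨Finset.mem_insert_self z A, fun e => ⟨hmem _, hmem _⟩, fun v hv => ?_, ?_, fun v => ?_,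
    ?_, ?_, fun B h1 h2 h3 => ?_⟩
  · refine Finset.sum_eq_zero fun u hu => absurd (hmem u) ?_
    rw [mem_pre, Finset.mem_singleton] at hu
    rwa [hu]
  · rw [sum_push, ← h.sum]
    exact Finset.sum_congr (by ext; simp) fun _ _ => rfl
  · rw [flux_mapArcs, three_mul_flux, ← h.par_sum]; rfl
  · rw [flux_mapArcs, push, pre_retract_root hzA, hcompl, hfl, hb]
  · rw [cutDeg_mapArcs, push, pre_retract_root hzA, hcompl, cutDeg_compl, dist0_neg, htight]
  · rw [herase] at h1 h3
    rw [sum_push, cutDeg_mapArcs, pre_retract hzA h1]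
    refine h.cut B (h1.trans hA) h2 fun hB => ?_
    exact hA' (Finset.Subset.antisymm hA (hB ▸ h1))

/-- Contract `A` and solve, which settles every arc not inside `A`; then contract the complement of
`A` into the root, where the crossing arcs are fixed, and solve inside `A`. -/
lemma sol_of_tight (h : Inst U z g b) (ih : SmallerSolvable U z g) {A : Finset V}
    (hA : A ⊆ U.erase z) (h2 : 2 ≤ A.card) (hA' : A ≠ U.erase z)
    (htight : cutDeg g A = 4 + dist0 (∑ v ∈ A, b v)) : Sol z g b := by
  have hzA : z ∉ A := fun hz => Finset.notMem_erase z U (hA hz)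
  have hAU : A ⊆ U := hA.trans (Finset.erase_subset z U)
  obtain ⟨a, ha⟩ : A.Nonempty := Finset.card_pos.1 (by omega)
  have hfz : collapse A a z = z := by simp [collapse, hzA]
  obtain ⟨σ, hσ1, hσ2, hσ3⟩ : Sol z (mapArcs (collapse A a) g) (push (collapse A a) b) := by
    refine ih _ _ _ ?_ (h.map (fun v => ?_) (fun v hv => ?_) (fun v hv => ?_))
    · have := sum_arcWeight_mapArcs_le hfz g
      have := card_image_collapse_lt (a := a) hAU h2
      unfold size; omega
    · by_cases hv : v ∈ A
      · simp only [collapse, hv, if_true]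
        constructor
        · rintro rfl; exact absurd ha hzA
        · rintro rfl; exact absurd hv hzA
      · simp [collapse, hv]
    · by_cases hvA : v ∈ A
      · simp only [collapse, hvA, if_true]; exact hAU ha
      · simpa [collapse, hvA] using hv
    · have : v ∉ A := fun h => hv (hAU h)
      simp [collapse, this]
  -- Redirecting along the first solution turns it into the constant 1, so the second problem can
  -- treat the crossing arcs as fixed.
  let ε : E → Bool := fun e => decide (σ e = 1)
  have hεσ : ∀ e, boolSign (ε e) = σ e := fun e => by
    rcases hσ1 e with h | h
    · simp [ε, boolSign, h]
    · rw [h]; simp only [ε, h]; decide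
  have hε : ∀ e, Meets z (g e) → ε e = true := fun e he => by
    simp only [ε, decide_eq_true_eq]
    refine hσ2 e ?_
    rcases he with he | he
    · left; simp [mapArcs, he, hfz]
    · right; simp [mapArcs, he, hfz]
  refine Sol.of_flip hε ?_
  have h' := h.flip hε
  have hfl : ∀ B, flux (flipArcs g ε) 1 B = flux g σ B := fun B => by
    rw [flux_flipArcs]; simp [hεσ]
  have hin : flux (flipArcs g ε) 1 A = ∑ v ∈ A, b v := by
    have := hσ3 a
    rwa [flux_mapArcs, push, pre_collapse_self ha, ← hfl] at this
  have hout : ∀ v, v ∉ A → flux (flipArcs g ε) 1 {v} = b v := fun v hv => by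
    have := hσ3 v
    rwa [flux_mapArcs, push, pre_collapse_of_notMem ha hv, Finset.sum_singleton, ← hfl] at this
  have hrz : ModThree.retract A z z = z := by simp [ModThree.retract]
  obtain ⟨τ, hτ1, hτ2, hτ3⟩ := ih _ _ _ (by
      have h1 := sum_arcWeight_mapArcs_le hrz (flipArcs g ε)
      have h3 := size_flipArcs (U := U) (z := z) g ε
      have h4 : (insert z A).card < U.card := by
        rw [Finset.card_insert_of_notMem hzA]
        have := Finset.card_lt_card (Finset.ssubset_iff_subset_ne.2 ⟨hA, hA'⟩)
        rw [Finset.card_erase_of_mem h.root_mem] at this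
        omega
      unfold size at h3 ⊢
      omega)
    (h'.retract hA hA' (by rw [cutDeg_flipArcs, htight]) hin)
  refine ⟨τ, hτ1, fun e he => hτ2 e ?_, fun v => ?_⟩
  · rcases he with he | he
    · left; simp [mapArcs, he, hrz]
    · right; simp [mapArcs, he, hrz]
  · by_cases hv : v ∈ A
    · have := hτ3 v
      rwa [flux_mapArcs, push, pre_retract hzA (by simpa using hv), Finset.sum_singleton] at this
    · rw [← hout v hv]
      refine Finset.sum_congr rfl fun e _ => ?_
      by_cases h1 : (flipArcs g ε e).1 = v
      · have : Meets z (mapArcs (ModThree.retract A z) (flipArcs g ε) e) := by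
          left; simp [mapArcs, ModThree.retract, h1, hv]
        simp [hτ2 e this]
      · by_cases h2 : (flipArcs g ε e).2 = v
        · have : Meets z (mapArcs (ModThree.retract A z) (flipArcs g ε) e) := by
            right; simp [mapArcs, ModThree.retract, h2, hv]
          simp [hτ2 e this]
        · simp [arcOn, h1, h2]

end ModThree

namespace ModThree

/-! ### Splitting off a vertex of degree four -/

variable {V E : Type*} [DecidableEq V] [Fintype V] [Fintype E] [DecidableEq E]
  {U : Finset V} {z : V} {g : E → V × V} {b : V → ZMod 6}

/-- At most two edges join the root to a vertex with zero boundary and degree four. -/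
lemma card_root_links_le_two (h : Inst U z g b) {x : V} (hx : x ∈ U.erase z) (hb : b x = 0)
    (hd : cutDeg g {x} = 4) (h2 : 2 ≤ (U.erase z).card) (T : Finset E)
    (hT : ∀ e ∈ T, g e = (z, x) ∨ g e = (x, z)) : T.card ≤ 2 := by
  have hxz : x ≠ z := Finset.ne_of_mem_erase hx
  have hcard := Finset.card_erase_of_mem hx
  have hcut := h.cut ((U.erase z).erase x) (Finset.erase_subset _ _)
    (Finset.card_pos.1 (by omega)) (fun h => Finset.notMem_erase x (U.erase z) (by rw [h]; exact hx))
  have hsum : ∑ v ∈ (U.erase z).erase x, b v = - b z := by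
    have h1 := Finset.add_sum_erase (U.erase z) b hx
    have h3 := Finset.add_sum_erase U b h.root_mem
    have h4 : ∑ v ∈ U, b v = 0 := by
      rw [← h.sum]
      exact Finset.sum_subset (Finset.subset_univ U) fun v _ hv => h.supp v hv
    rw [hb, zero_add] at h1
    rw [h1]; linear_combination h3 + h4
  rw [hsum, dist0_neg] at hcut
  have hz := h.rootDeg
  -- An edge of `T` is counted twice on the right and does not meet the remaining vertices. With the
  -- degree bound at `z` and the lower bound for the remaining set, this leaves `2 * T.card ≤ 4`.
  have key : cutDeg g ((U.erase z).erase x) + 2 * T.card ≤ cutDeg g {z} + cutDeg g {x} := by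
    have : T.card = ∑ e, if e ∈ T then 1 else 0 := by simp
    rw [this, Finset.mul_sum]
    unfold cutDeg
    rw [← Finset.sum_add_distrib, ← Finset.sum_add_distrib]
    refine Finset.sum_le_sum fun e _ => ?_
    by_cases heT : e ∈ T
    · rcases hT e heT with he | he <;> simp [crosses, heT, he, hxz, hxz.symm]
    · have h1 := (h.ends e).1
      have h2 := (h.ends e).2
      simp only [crosses, heT, if_false, Finset.mem_erase, h1, h2, Finset.mem_singleton]
      by_cases a1 : (g e).1 = z <;> by_cases a2 : (g e).1 = x <;>
        by_cases a3 : (g e).2 = z <;> by_cases a4 : (g e).2 = x <;>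
        simp [a1, a2, a3, a4]
  omega

/-- Replace the arcs `e₁, e₂` by an arc on `e₁`, the arcs `e₃, e₄` by an arc on `e₃`, and remove
all other arcs at `x`. -/
def liftArcs (g : E → V × V) (x z : V) (e₁ e₃ : E) (p₁ p₃ : V × V) (e : E) : V × V :=
  if e = e₁ then p₁ else if e = e₃ then p₃ else
    if (g e).1 = x ∨ (g e).2 = x then (z, z) else g e

lemma sum_split_four {M : Type*} [AddCommMonoid M] (f : E → M) {e₁ e₂ e₃ e₄ : E}
    (h12 : e₁ ≠ e₂) (h13 : e₁ ≠ e₃) (h14 : e₁ ≠ e₄) (h23 : e₂ ≠ e₃) (h24 : e₂ ≠ e₄)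
    (h34 : e₃ ≠ e₄) :
    ∑ e, f e = ∑ e ∈ Finset.univ \ {e₁, e₂, e₃, e₄}, f e + (f e₁ + (f e₂ + (f e₃ + f e₄))) := by
  rw [← Finset.sum_sdiff (Finset.subset_univ ({e₁, e₂, e₃, e₄} : Finset E))]
  congr 1
  rw [Finset.sum_insert (by simp [h12, h13, h14]), Finset.sum_insert (by simp [h23, h24]),
    Finset.sum_pair h34]

/-- Four arcs at a vertex of degree four, alternately entering and leaving. -/
structure FourArcs (g : E → V × V) (x : V) (e₁ e₂ e₃ e₄ : E) (y₁ y₂ y₃ y₄ : V) : Prop where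
  h12 : e₁ ≠ e₂
  h13 : e₁ ≠ e₃
  h14 : e₁ ≠ e₄
  h23 : e₂ ≠ e₃
  h24 : e₂ ≠ e₄
  h34 : e₃ ≠ e₄
  deg : cutDeg g {x} = 4
  g1 : g e₁ = (y₁, x)
  g2 : g e₂ = (x, y₂)
  g3 : g e₃ = (y₃, x)
  g4 : g e₄ = (x, y₄)
  n1 : y₁ ≠ x
  n2 : y₂ ≠ x
  n3 : y₃ ≠ x
  n4 : y₄ ≠ x

section four
variable {x : V} {e₁ e₂ e₃ e₄ : E} {y₁ y₂ y₃ y₄ : V}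

lemma FourArcs.loop (F : FourArcs g x e₁ e₂ e₃ e₄ y₁ y₂ y₃ y₄) {e : E}
    (he : e ∈ (Finset.univ \ {e₁, e₂, e₃, e₄} : Finset E)) (hx : (g e).1 = x ∨ (g e).2 = x) :
    g e = (x, x) := by
  have h1 := F.deg
  unfold cutDeg at h1
  rw [sum_split_four _ F.h12 F.h13 F.h14 F.h23 F.h24 F.h34] at h1
  simp only [F.g1, F.g2, F.g3, F.g4] at h1
  simp only [crosses, Finset.mem_singleton, F.n1, F.n2, F.n3, F.n4] at h1
  have h2 : ∑ e ∈ Finset.univ \ {e₁, e₂, e₃, e₄}, crosses (g e) {x} = 0 := by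
    simp only [crosses, Finset.mem_singleton]
    simp at h1
    simpa using h1
  rw [Finset.sum_eq_zero_iff] at h2
  have h3 := h2 e he
  simp only [crosses, Finset.mem_singleton] at h3
  split_ifs at h3 with h4
  rcases hx with hx | hx
  · exact Prod.ext hx (h4.1 hx)
  · exact Prod.ext (h4.2 hx) hx

/-- Stated for any arc statistic vanishing on loops, so that it specialises to outflow, weight and
cut degree. Subtraction is avoided because two of these take natural values. -/
lemma FourArcs.sum_lift {M : Type*} [AddCommMonoid M]
    (F : FourArcs g x e₁ e₂ e₃ e₄ y₁ y₂ y₃ y₄) (f : E → V × V → M)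
    (hf : ∀ e v, f e (v, v) = 0) :
    ∑ e, f e (liftArcs g x z e₁ e₃ (y₁, y₂) (y₃, y₄) e)
      + (f e₁ (y₁, x) + (f e₂ (x, y₂) + (f e₃ (y₃, x) + f e₄ (x, y₄))))
      = ∑ e, f e (g e) + (f e₁ (y₁, y₂) + f e₃ (y₃, y₄)) := by
  rw [sum_split_four _ F.h12 F.h13 F.h14 F.h23 F.h24 F.h34,
    sum_split_four (fun e => f e (g e)) F.h12 F.h13 F.h14 F.h23 F.h24 F.h34]
  have : ∑ e ∈ Finset.univ \ {e₁, e₂, e₃, e₄},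
      f e (liftArcs g x z e₁ e₃ (y₁, y₂) (y₃, y₄) e)
      = ∑ e ∈ Finset.univ \ {e₁, e₂, e₃, e₄}, f e (g e) := by
    refine Finset.sum_congr rfl fun e he => ?_
    have he' := he
    simp only [Finset.mem_sdiff, Finset.mem_univ, true_and, Finset.mem_insert,
      Finset.mem_singleton, not_or] at he'
    unfold liftArcs
    rw [if_neg he'.1, if_neg he'.2.2.1]
    split_ifs with h
    · rw [F.loop he h, hf, hf]
    · rfl
  rw [this]
  have l1 : liftArcs g x z e₁ e₃ (y₁, y₂) (y₃, y₄) e₁ = (y₁, y₂) := by simp [liftArcs]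
  have l2 : liftArcs g x z e₁ e₃ (y₁, y₂) (y₃, y₄) e₂ = (z, z) := by
    simp [liftArcs, F.h12.symm, F.h23, F.g2]
  have l3 : liftArcs g x z e₁ e₃ (y₁, y₂) (y₃, y₄) e₃ = (y₃, y₄) := by
    simp [liftArcs, F.h13.symm]
  have l4 : liftArcs g x z e₁ e₃ (y₁, y₂) (y₃, y₄) e₄ = (z, z) := by
    simp [liftArcs, F.h14.symm, F.h34.symm, F.g4]
  simp only [l1, l2, l3, l4, hf, F.g1, F.g2, F.g3, F.g4]
  abel

lemma FourArcs.ends_ne (F : FourArcs g x e₁ e₂ e₃ e₄ y₁ y₂ y₃ y₄) (hxz : x ≠ z) (e : E) :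
    (liftArcs g x z e₁ e₃ (y₁, y₂) (y₃, y₄) e).1 ≠ x ∧
      (liftArcs g x z e₁ e₃ (y₁, y₂) (y₃, y₄) e).2 ≠ x := by
  unfold liftArcs
  split_ifs with h1 h2 h3
  · exact ⟨F.n1, F.n2⟩
  · exact ⟨F.n3, F.n4⟩
  · exact ⟨hxz.symm, hxz.symm⟩
  · exact not_or.1 h3

lemma FourArcs.flux_lift {R : Type*} [Ring R] (F : FourArcs g x e₁ e₂ e₃ e₄ y₁ y₂ y₃ y₄)
    (σ : E → R) (h1 : σ e₂ = σ e₁) (h2 : σ e₄ = σ e₃) (A : Finset V) :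
    flux (liftArcs g x z e₁ e₃ (y₁, y₂) (y₃, y₄)) σ A = flux g σ A := by
  have := F.sum_lift (z := z) (fun e p => σ e * arcOn R p A) (fun e v => by simp [arcOn])
  simp only [h1, h2, ← mul_add, ← add_assoc] at this
  unfold flux
  have e1 : ∀ y y' : V, arcOn R (y, y') A = arcOn R (y, x) A + arcOn R (x, y') A := by
    intro y y'; simp [arcOn]
  rw [e1 y₁ y₂, e1 y₃ y₄] at this
  simp only [mul_add, ← add_assoc] at this ⊢
  simpa using this

lemma FourArcs.size_lift (F : FourArcs g x e₁ e₂ e₃ e₄ y₁ y₂ y₃ y₄) (hxz : x ≠ z) :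
    ∑ e, arcWeight z (liftArcs g x z e₁ e₃ (y₁, y₂) (y₃, y₄) e) ≤ ∑ e, arcWeight z (g e) := by
  have := F.sum_lift (z := z) (fun _ p => arcWeight z p) (fun _ v => by simp [arcWeight])
  have key : ∀ y y', y ≠ x → y' ≠ x →
      arcWeight z (y, y') ≤ arcWeight z (y, x) + arcWeight z (x, y') := by
    intro y y' h h'
    simp only [arcWeight, h, h'.symm, hxz, if_false]
    split_ifs <;> simp_all
  have k1 := key y₁ y₂ F.n1 F.n2
  have k2 := key y₃ y₄ F.n3 F.n4
  omega

lemma FourArcs.cutDeg_lift (F : FourArcs g x e₁ e₂ e₃ e₄ y₁ y₂ y₃ y₄) (A : Finset V) :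
    cutDeg (liftArcs g x z e₁ e₃ (y₁, y₂) (y₃, y₄)) A
      + (crosses (y₁, x) A + (crosses (x, y₂) A + (crosses (y₃, x) A + crosses (x, y₄) A)))
      = cutDeg g A + (crosses (y₁, y₂) A + crosses (y₃, y₄) A) :=
  F.sum_lift (fun _ p => crosses p A) (fun _ v => by simp [crosses])

lemma FourArcs.cutDeg_insert (F : FourArcs g x e₁ e₂ e₃ e₄ y₁ y₂ y₃ y₄) (hxz : x ≠ z)
    (A : Finset V) :
    cutDeg (liftArcs g x z e₁ e₃ (y₁, y₂) (y₃, y₄)) (insert x A)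
      = cutDeg (liftArcs g x z e₁ e₃ (y₁, y₂) (y₃, y₄)) A := by
  refine Finset.sum_congr rfl fun e _ => ?_
  have := F.ends_ne hxz e
  simp [crosses, this.1, this.2]

/-- After lifting, `x` is isolated, so `A` and `insert x A` have the same cut, and each can be
bounded from the original one. The two bounds fail together only when `A` contains both ends of one
pair and neither end of the other. `Slack` covers this for larger `A`; `m1` and `m2` exclude it for
single vertices. -/
lemma sol_of_fourArcs (h : Inst U z g b) (hs : Slack U z g b) (ih : SmallerSolvable U z g)
    (F : FourArcs g x e₁ e₂ e₃ e₄ y₁ y₂ y₃ y₄) (hx : x ∈ U.erase z) (hb : b x = 0)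
    (m1 : y₁ = y₂ → y₃ = y₁ ∨ y₄ = y₁) (m2 : y₃ = y₄ → y₁ = y₃ ∨ y₂ = y₃) : Sol z g b := by
  have hxz : x ≠ z := Finset.ne_of_mem_erase hx
  have hxU : x ∈ U := Finset.mem_of_mem_erase hx
  have hfl : ∀ A, flux (liftArcs g x z e₁ e₃ (y₁, y₂) (y₃, y₄)) (1 : E → ZMod 6) A = flux g 1 A :=
    F.flux_lift 1 rfl rfl
  have herase : (U.erase x).erase z = (U.erase z).erase x := Finset.erase_right_comm
  have hinst : Inst (U.erase x) z (liftArcs g x z e₁ e₃ (y₁, y₂) (y₃, y₄)) b := by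
    refine ⟨Finset.mem_erase.2 ⟨hxz.symm, h.root_mem⟩, fun e => ?_, fun v hv => ?_, h.sum,
      fun v => ?_, ?_, ?_, fun A h1 h2 h3 => ?_⟩
    · have := F.ends_ne hxz e
      refine ⟨Finset.mem_erase.2 ⟨this.1, ?_⟩, Finset.mem_erase.2 ⟨this.2, ?_⟩⟩
      all_goals
        have k1 := h.ends e₁
        have k2 := h.ends e₂
        have k3 := h.ends e₃
        have k4 := h.ends e₄
        have k := h.ends e
        have kz := h.root_mem
        rw [F.g1] at k1
        rw [F.g2] at k2
        rw [F.g3] at k3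
        rw [F.g4] at k4
        unfold liftArcs
        split_ifs
        all_goals simp_all
    · by_cases hvx : v = x
      · rw [hvx, hb]
      · exact h.supp v fun hvU => hv (Finset.mem_erase.2 ⟨hvx, hvU⟩)
    · rw [hfl]; exact h.par v
    · rw [hfl]; exact h.root
    · refine le_trans ?_ h.rootDeg
      have := F.cutDeg_lift (z := z) {z}
      have k : ∀ y y' : V, crosses (y, y') {z} ≤ crosses (y, x) {z} + crosses (x, y') {z} := by
        intro y y'
        by_cases a : y = z <;> by_cases a' : y' = z <;> simp [crosses, a, a', hxz]
      have k1 := k y₁ y₂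
      have k2 := k y₃ y₄
      omega
    · rw [herase] at h1 h3
      have hA : A ⊆ U.erase z := h1.trans (Finset.erase_subset _ _)
      have hxA : x ∉ A := fun h' => Finset.notMem_erase x _ (h1 h')
      have hAne : A ≠ U.erase z := fun h' => hxA (h' ▸ hx)
      have hins : insert x A ≠ U.erase z := fun h' => h3 (by
        rw [← h', Finset.erase_insert hxA])
      have c1 := h.cut A hA h2 hAne
      have c2 := h.cut (insert x A) (Finset.insert_subset hx hA) (Finset.insert_nonempty x A) hins
      rw [Finset.sum_insert hxA, hb, zero_add] at c2
      have c3 : 6 + dist0 (∑ v ∈ A, b v) ≤ cutDeg g A ∨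
          ((y₁ ∈ A → y₂ ∈ A → y₃ ∈ A ∨ y₄ ∈ A) ∧ (y₃ ∈ A → y₄ ∈ A → y₁ ∈ A ∨ y₂ ∈ A)) := by
        rcases hs.singleton_or hA h2 hAne with ⟨v, rfl⟩ | c3
        · simp only [Finset.mem_singleton]
          refine Or.inr ⟨?_, ?_⟩
          · rintro rfl h'; exact m1 h'.symm
          · rintro rfl h'; exact m2 h'.symm
        · exact Or.inl c3
      have d1 := F.cutDeg_lift (z := z) A
      have d2 := F.cutDeg_lift (z := z) (insert x A)
      rw [F.cutDeg_insert hxz] at d2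
      have n1 := F.n1
      have n2 := F.n2
      have n3 := F.n3
      have n4 := F.n4
      by_cases a1 : y₁ ∈ A <;> by_cases a2 : y₂ ∈ A <;> by_cases a3 : y₃ ∈ A <;>
        by_cases a4 : y₄ ∈ A <;>
        simp [crosses, hxA, a1, a2, a3, a4, n1, n2, n3, n4] at c3 d1 d2 <;> omega
  obtain ⟨σ, hσ1, hσ2, hσ3⟩ := ih _ _ _ (by
    have h1 := F.size_lift hxz
    have h2 := Finset.card_erase_of_mem hxU
    have h3 := Finset.card_pos.2 ⟨x, hxU⟩
    unfold size; omega) hinst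
  have l1 : liftArcs g x z e₁ e₃ (y₁, y₂) (y₃, y₄) e₁ = (y₁, y₂) := by simp [liftArcs]
  have l3 : liftArcs g x z e₁ e₃ (y₁, y₂) (y₃, y₄) e₃ = (y₃, y₄) := by
    simp [liftArcs, F.h13.symm]
  have l2 : liftArcs g x z e₁ e₃ (y₁, y₂) (y₃, y₄) e₂ = (z, z) := by
    simp [liftArcs, F.h12.symm, F.h23, F.g2]
  have l4 : liftArcs g x z e₁ e₃ (y₁, y₂) (y₃, y₄) e₄ = (z, z) := by
    simp [liftArcs, F.h14.symm, F.h34.symm, F.g4]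
  -- Both arcs of a lifted pair take the sign of the arc that replaced them.
  let τ : E → ZMod 6 := fun e => if e = e₂ then σ e₁ else if e = e₄ then σ e₃ else σ e
  have t1 : τ e₁ = σ e₁ := by simp [τ, F.h12, F.h14]
  have t2 : τ e₂ = σ e₁ := by simp [τ]
  have t3 : τ e₃ = σ e₃ := by simp [τ, F.h23.symm, F.h34]
  have t4 : τ e₄ = σ e₃ := by simp [τ, F.h24.symm]
  refine ⟨τ, fun e => ?_, fun e he => ?_, fun v => ?_⟩
  · simp only [τ]; split_ifs
    · exact hσ1 _
    · exact hσ1 _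
    · exact hσ1 _
  · by_cases a2 : e = e₂
    · rw [a2, t2]
      refine hσ2 _ ?_
      rw [l1]; rw [a2, F.g2] at he
      rcases he with he | he
      · exact absurd he hxz
      · exact Or.inr he
    · by_cases a4 : e = e₄
      · rw [a4, t4]
        refine hσ2 _ ?_
        rw [l3]; rw [a4, F.g4] at he
        rcases he with he | he
        · exact absurd he hxz
        · exact Or.inr he
      · have : τ e = σ e := by simp [τ, a2, a4]
        rw [this]
        refine hσ2 _ ?_
        unfold liftArcs
        split_ifs with b1 b3 b5
        · rw [b1, F.g1] at he
          rcases he with he | he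
          · exact Or.inl he
          · exact absurd he hxz
        · rw [b3, F.g3] at he
          rcases he with he | he
          · exact Or.inl he
          · exact absurd he hxz
        · exact Or.inl rfl
        · exact he
  · rw [← hσ3 v, ← F.flux_lift (z := z) τ (t2.trans t1.symm) (t4.trans t3.symm)]
    refine Finset.sum_congr rfl fun e _ => ?_
    by_cases a2 : e = e₂
    · rw [a2, l2]; simp [arcOn]
    · by_cases a4 : e = e₄
      · rw [a4, l4]; simp [arcOn]
      · simp [τ, a2, a4]

end four

end ModThree

namespace ModThree

/-! ### Choosing the pairs to split off -/

variable {V E : Type*} [DecidableEq V] [Fintype V] [Fintype E] [DecidableEq E]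
  {U : Finset V} {z : V} {g : E → V × V} {b : V → ZMod 6}

lemma Slack.flip (hs : Slack U z g b) (ε : E → Bool) : Slack U z (flipArcs g ε) b :=
  fun A h1 h2 h3 => by rw [cutDeg_flipArcs]; exact hs A h1 h2 h3

lemma SmallerSolvable.flip (ih : SmallerSolvable U z g) (ε : E → Bool) :
    SmallerSolvable U z (flipArcs g ε) :=
  fun U' g' b' hlt => ih U' g' b' (by rwa [size_flipArcs] at hlt)

/-- Some arc `e` joins `x` and `y`. -/
def Joins (g : E → V × V) (e : E) (x y : V) : Prop := g e = (y, x) ∨ g e = (x, y)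

/-- At the root, one arc of a pair enters `x` and the other leaves `x`. -/
def PassesRoot (g : E → V × V) (x z : V) (e e' : E) (y y' : V) : Prop :=
  (y = z → g e = (z, x)) ∧ (y' = z → g e' = (x, z))

lemma sol_of_passing (h : Inst U z g b) (hs : Slack U z g b) (ih : SmallerSolvable U z g)
    {x : V} (hx : x ∈ U.erase z) (hb : b x = 0) (hd : cutDeg g {x} = 4)
    {e₁ e₂ e₃ e₄ : E} {y₁ y₂ y₃ y₄ : V}
    (h12 : e₁ ≠ e₂) (h13 : e₁ ≠ e₃) (h14 : e₁ ≠ e₄) (h23 : e₂ ≠ e₃) (h24 : e₂ ≠ e₄)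
    (h34 : e₃ ≠ e₄)
    (g1 : Joins g e₁ x y₁) (g2 : Joins g e₂ x y₂) (g3 : Joins g e₃ x y₃) (g4 : Joins g e₄ x y₄)
    (n1 : y₁ ≠ x) (n2 : y₂ ≠ x) (n3 : y₃ ≠ x) (n4 : y₄ ≠ x)
    (p1 : PassesRoot g x z e₁ e₂ y₁ y₂) (p3 : PassesRoot g x z e₃ e₄ y₃ y₄)
    (m1 : y₁ = y₂ → y₃ = y₁ ∨ y₄ = y₁) (m2 : y₃ = y₄ → y₁ = y₃ ∨ y₂ = y₃) : Sol z g b := by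
  have hxz : x ≠ z := Finset.ne_of_mem_erase hx
  -- Make `e₁`, `e₃` enter `x` and `e₂`, `e₄` leave it; by `p1` and `p3` no arc at the root is
  -- reversed.
  let ε : E → Bool := fun e => if e = e₁ ∨ e = e₃ then decide ((g e).2 = x) else
    if e = e₂ ∨ e = e₄ then decide ((g e).1 = x) else true
  have hε : ∀ e, Meets z (g e) → ε e = true := by
    intro e he
    by_cases h1 : e = e₁ ∨ e = e₃
    · simp only [ε, h1, if_true, decide_eq_true_eq]
      rcases h1 with rfl | rfl
      · rcases g1 with g1 | g1
        · simp [g1]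
        · simp only [Meets, g1, hxz, false_or] at he
          rw [p1.1 he]
      · rcases g3 with g1 | g1
        · simp [g1]
        · simp only [Meets, g1, hxz, false_or] at he
          rw [p3.1 he]
    · by_cases h2 : e = e₂ ∨ e = e₄
      · simp only [ε, h1, h2, if_true, if_false, decide_eq_true_eq]
        rcases h2 with rfl | rfl
        · rcases g2 with g1 | g1
          · simp only [Meets, g1, hxz, or_false] at he
            rw [p1.2 he]
          · simp [g1]
        · rcases g4 with g1 | g1
          · simp only [Meets, g1, hxz, or_false] at he
            rw [p3.2 he]
          · simp [g1]
      · simp only [ε, h1, h2, if_false]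
  refine Sol.of_flip hε (sol_of_fourArcs (h.flip hε) (hs.flip ε) (ih.flip ε)
    (e₁ := e₁) (e₂ := e₂) (e₃ := e₃) (e₄ := e₄) (y₁ := y₁) (y₂ := y₂) (y₃ := y₃) (y₄ := y₄)
    ⟨h12, h13, h14, h23, h24, h34, by rw [cutDeg_flipArcs, hd], ?_, ?_, ?_, ?_, n1, n2, n3, n4⟩
    hx hb m1 m2)
  · rcases g1 with g1 | g1 <;> simp [flipArcs, ε, g1, n1]
  · rcases g2 with g1 | g1 <;> simp [flipArcs, ε, g1, n2, h12.symm, h23]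
  · rcases g3 with g1 | g1 <;> simp [flipArcs, ε, g1, n3]
  · rcases g4 with g1 | g1 <;> simp [flipArcs, ε, g1, n4, h14.symm, h34.symm]

lemma Joins.passesRoot_or {x : V} {e e' : E} {y y' : V} (h : Joins g e x y) (h' : Joins g e' x y')
    (hne : ¬ (y = z ∧ y' = z)) : PassesRoot g x z e e' y y' ∨ PassesRoot g x z e' e y' y := by
  unfold Joins at h h'
  unfold PassesRoot
  by_cases hy : y = z <;> by_cases hy' : y' = z
  · exact absurd ⟨hy, hy'⟩ hne
  · rcases h with h | h <;> simp_all
  · rcases h' with h | h <;> simp_all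
  · simp_all

/-- A pair whose arcs both go to the root could have incompatible fixed directions. But then `m1` or
`m2` gives a third link to the root, against `card_root_links_le_two`. Any other pair can be ordered
so that it passes through `x`. -/
lemma sol_of_pairing (h : Inst U z g b) (hs : Slack U z g b) (ih : SmallerSolvable U z g)
    {x : V} (hx : x ∈ U.erase z) (hb : b x = 0) (hd : cutDeg g {x} = 4)
    (hcard : 2 ≤ (U.erase z).card)
    {e₁ e₂ e₃ e₄ : E} {y₁ y₂ y₃ y₄ : V}
    (h12 : e₁ ≠ e₂) (h13 : e₁ ≠ e₃) (h14 : e₁ ≠ e₄) (h23 : e₂ ≠ e₃) (h24 : e₂ ≠ e₄)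
    (h34 : e₃ ≠ e₄)
    (g1 : Joins g e₁ x y₁) (g2 : Joins g e₂ x y₂) (g3 : Joins g e₃ x y₃) (g4 : Joins g e₄ x y₄)
    (n1 : y₁ ≠ x) (n2 : y₂ ≠ x) (n3 : y₃ ≠ x) (n4 : y₄ ≠ x)
    (m1 : y₁ = y₂ → y₃ = y₁ ∨ y₄ = y₁) (m2 : y₃ = y₄ → y₁ = y₃ ∨ y₂ = y₃) : Sol z g b := by
  have links : ∀ a a' a'' : E, a ≠ a' → a ≠ a'' → a' ≠ a'' → Joins g a x z → Joins g a' x z →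
      Joins g a'' x z → False := by
    intro a a' a'' k1 k2 k3 j1 j2 j3
    have := card_root_links_le_two h hx hb hd hcard {a, a', a''} (by
      intro e he
      simp only [Finset.mem_insert, Finset.mem_singleton] at he
      rcases he with rfl | rfl | rfl
      · exact j1
      · exact j2
      · exact j3)
    rw [Finset.card_eq_three.2 ⟨a, a', a'', k1, k2, k3, rfl⟩] at this
    omega
  have z1 : ¬ (y₁ = z ∧ y₂ = z) := by
    rintro ⟨rfl, rfl⟩
    rcases m1 rfl with rfl | rfl
    · exact links _ _ _ h12 h13 h23 g1 g2 g3
    · exact links _ _ _ h12 h14 h24 g1 g2 g4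
  have z3 : ¬ (y₃ = z ∧ y₄ = z) := by
    rintro ⟨rfl, rfl⟩
    rcases m2 rfl with rfl | rfl
    · exact links _ _ _ h13 h14 h34 g1 g3 g4
    · exact links _ _ _ h23 h24 h34 g2 g3 g4
  rcases g1.passesRoot_or g2 z1 with p1 | p1 <;> rcases g3.passesRoot_or g4 z3 with p3 | p3
  · exact sol_of_passing h hs ih hx hb hd h12 h13 h14 h23 h24 h34 g1 g2 g3 g4 n1 n2 n3 n4 p1 p3
      m1 m2
  · exact sol_of_passing h hs ih hx hb hd h12 h14 h13 h24 h23 h34.symm g1 g2 g4 g3 n1 n2 n4 n3 p1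
      p3 (fun k => (m1 k).symm) (fun k => k ▸ m2 k.symm)
  · exact sol_of_passing h hs ih hx hb hd h12.symm h23 h24 h13 h14 h34 g2 g1 g3 g4 n2 n1 n3 n4 p1
      p3 (fun k => k ▸ m1 k.symm) (fun k => (m2 k).symm)
  · exact sol_of_passing h hs ih hx hb hd h12.symm h24 h23 h14 h13 h34.symm g2 g1 g4 g3 n2 n1 n4
      n3 p1 p3 (fun k => (k ▸ m1 k.symm).symm) (fun k => (k ▸ m2 k.symm).symm)

lemma cutDeg_eq_card (g : E → V × V) (A : Finset V) :
    cutDeg g A = (Finset.univ.filter fun e => crosses (g e) A = 1).card := by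
  rw [Finset.card_filter]
  refine Finset.sum_congr rfl fun e _ => ?_
  have := crosses_le_one (g e) A
  split_ifs <;> omega

lemma exists_joins {e : E} {x : V} (h : crosses (g e) {x} = 1) : ∃ y, y ≠ x ∧ Joins g e x y := by
  unfold crosses at h
  simp only [Finset.mem_singleton] at h
  by_cases h1 : (g e).1 = x <;> by_cases h2 : (g e).2 = x
  · simp [h1, h2] at h
  · exact ⟨_, h2, Or.inr (Prod.ext h1 rfl)⟩
  · exact ⟨_, h1, Or.inl (Prod.ext rfl h2)⟩
  · simp [h1, h2] at h

lemma sol_of_degree_four (h : Inst U z g b) (hs : Slack U z g b) (ih : SmallerSolvable U z g)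
    {x : V} (hx : x ∈ U.erase z) (hb : b x = 0) (hd : cutDeg g {x} = 4)
    (hcard : 2 ≤ (U.erase z).card) : Sol z g b := by
  have hc := hd
  rw [cutDeg_eq_card] at hc
  obtain ⟨e₁, t, ht, hte, htc⟩ := Finset.card_eq_succ.1 hc
  obtain ⟨e₂, e₃, e₄, h23, h24, h34, rfl⟩ := Finset.card_eq_three.1 htc
  simp only [Finset.mem_insert, Finset.mem_singleton, not_or] at ht
  have hm : ∀ e ∈ insert e₁ ({e₂, e₃, e₄} : Finset E), crosses (g e) {x} = 1 := fun e he => by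
    rw [hte] at he; exact (Finset.mem_filter.1 he).2
  obtain ⟨y₁, n1, g1⟩ := exists_joins (hm e₁ (by simp))
  obtain ⟨y₂, n2, g2⟩ := exists_joins (hm e₂ (by simp))
  obtain ⟨y₃, n3, g3⟩ := exists_joins (hm e₃ (by simp))
  obtain ⟨y₄, n4, g4⟩ := exists_joins (hm e₄ (by simp))
  obtain ⟨h12, h13, h14⟩ := ht
  -- If a pair has equal ends, exchange partners: a new pair with equal ends then shares its end
  -- with a third arc.
  by_cases hy : y₁ = y₂ ∨ y₃ = y₄
  · refine sol_of_pairing h hs ih hx hb hd hcard h13 h12 h14 h23.symm h34 h24 g1 g3 g2 g4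
      n1 n3 n2 n4 ?_ ?_
    · rintro rfl; exact hy.imp Eq.symm Eq.symm
    · rintro rfl; exact hy
  · push Not at hy
    exact sol_of_pairing h hs ih hx hb hd hcard h12 h13 h14 h23 h24 h34 g1 g2 g3 g4
      n1 n2 n3 n4 (fun k => absurd k hy.1) (fun k => absurd k hy.2)

end ModThree

namespace ModThree

/-! ### The induction for rooted orientation problems -/

variable {V E : Type*} [DecidableEq V] [Fintype V] [Fintype E] [DecidableEq E]
  {U : Finset V} {z : V} {g : E → V × V} {b : V → ZMod 6}

/-- The boundary is right at the root, and both outflow and boundary sum to zero, so it is right at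
the only other vertex. -/
lemma sol_of_card_le_one (h : Inst U z g b) (hcard : (U.erase z).card ≤ 1) : Sol z g b := by
  refine ⟨1, fun _ => Or.inl rfl, fun _ _ => rfl, fun v => ?_⟩
  by_cases hvU : v ∈ U
  · by_cases hvz : v = z
    · rw [hvz, h.root]
    · have hsum : ∑ u, (flux g 1 {u} - b u) = 0 := by
        rw [Finset.sum_sub_distrib, h.sum, sum_flux, flux_univ, sub_zero]
      rw [Finset.sum_eq_single v] at hsum
      · exact sub_eq_zero.1 hsum
      · intro u _ huv
        by_cases huU : u ∈ U
        · by_cases huz : u = z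
          · rw [huz, h.root, sub_self]
          · exact absurd (Finset.card_le_one.1 hcard u (Finset.mem_erase.2 ⟨huz, huU⟩) v
              (Finset.mem_erase.2 ⟨hvz, hvU⟩)) huv
        · rw [h.supp u huU, flux_eq_zero_of_ends h.ends _ huU, sub_zero]
      · simp
  · rw [h.supp v hvU, flux_eq_zero_of_ends h.ends _ hvU]

/-- Reverse a single arc. -/
def keepExcept (e : E) (e' : E) : Bool := decide (e' ≠ e)

lemma keepExcept_of_not_meets {e : E} (he : ¬ Meets z (g e)) (e' : E) (h : Meets z (g e')) :
    keepExcept e e' = true := by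
  have : e' ≠ e := by rintro rfl; exact he h
  simpa [keepExcept] using this

lemma flipArcs_keepExcept_self (e : E) : flipArcs g (keepExcept e) e = (g e).swap := by
  simp [flipArcs, keepExcept]

lemma flipArcs_keepExcept_of_ne {e e' : E} (h : e' ≠ e) :
    flipArcs g (keepExcept e) e' = g e' := by
  simp [flipArcs, keepExcept, h]

lemma sol_of_delete_joins (h : Inst U z g b) (hs : Slack U z g b) (ih : SmallerSolvable U z g)
    {e : E} {x y : V} (hg : Joins g e x y) (hxy : x ≠ y) (hxz : x ≠ z) (hyz : y ≠ z)
    (hx : 5 + dist0 (b x - 1) ≤ cutDeg g {x})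
    (hy : 5 + dist0 (b y + 1) ≤ cutDeg g {y}) : Sol z g b := by
  rcases hg with hg | hg
  · have hm : ¬ Meets z (g e) := by simp [Meets, hg, hxz, hyz]
    have hε := keepExcept_of_not_meets (g := g) hm
    refine Sol.of_flip hε (sol_of_delete (h.flip hε) (hs.flip _) (ih.flip _) (e := e)
      (x := x) (y := y) ?_ hxy ?_ ?_)
    · rw [flipArcs_keepExcept_self, hg]; rfl
    · rw [cutDeg_flipArcs]; exact fun _ => hx
    · rw [cutDeg_flipArcs]; exact fun _ => hy
  · exact sol_of_delete h hs ih hg hxy (fun _ => hx) (fun _ => hy)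

lemma sol_of_move_joins (h : Inst U z g b) (hs : Slack U z g b) (ih : SmallerSolvable U z g)
    {e : E} {x y : V} (hg : Joins g e x y) (hxy : x ≠ y) (hxz : x ≠ z) (hyz : y ≠ z)
    (hx : 5 + dist0 (b x - 1) ≤ cutDeg g {x})
    (hr : cutDeg g {z} + 1 ≤ 4 + dist0 (b z + 1)) : Sol z g b := by
  rcases hg with hg | hg
  · have hm : ¬ Meets z (g e) := by simp [Meets, hg, hxz, hyz]
    have hε := keepExcept_of_not_meets (g := g) hm
    refine Sol.of_flip hε (sol_of_move (h.flip hε) (hs.flip _) (ih.flip _) (e := e)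
      (x := x) (y := y) ?_ hxy hxz hyz ?_ ?_)
    · rw [flipArcs_keepExcept_self, hg]; rfl
    · rw [cutDeg_flipArcs]; exact hx
    · rw [cutDeg_flipArcs]; exact hr
  · exact sol_of_move h hs ih hg hxy hxz hyz hx hr

lemma sol_of_turn_joins (h : Inst U z g b) (hs : Slack U z g b) (ih : SmallerSolvable U z g)
    {e e' : E} {x y : V} (hg : g e = (z, x)) (hg' : Joins g e' x y) (hxy : x ≠ y) (hxz : x ≠ z)
    (hyz : y ≠ z)
    (hx : 4 + dist0 (b x + 4) ≤ cutDeg g {x})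
    (hy : 5 + dist0 (b y - 1) ≤ cutDeg g {y})
    (hr : cutDeg g {z} + 1 ≤ 4 + dist0 (b z - 3)) : Sol z g b := by
  rcases hg' with hg' | hg'
  · exact sol_of_turn h hs ih hg hg' hxy hxz hyz hx hy hr
  · have hm : ¬ Meets z (g e') := by simp [Meets, hg', hxz, hyz]
    have hε := keepExcept_of_not_meets (g := g) hm
    have hee : e ≠ e' := by rintro rfl; exact hm (Or.inl (by rw [hg]))
    refine Sol.of_flip hε (sol_of_turn (h.flip hε) (hs.flip _) (ih.flip _) (e := e) (e' := e')
      (x := x) (y := y) ?_ ?_ hxy hxz hyz ?_ ?_ ?_)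
    · rw [flipArcs_keepExcept_of_ne hee, hg]
    · rw [flipArcs_keepExcept_self, hg']; rfl
    · rw [cutDeg_flipArcs]; exact hx
    · rw [cutDeg_flipArcs]; exact hy
    · rw [cutDeg_flipArcs]; exact hr

lemma Joins.mem (h : Inst U z g b) {e : E} {x y : V} (hj : Joins g e x y) : x ∈ U ∧ y ∈ U := by
  have := h.ends e
  rcases hj with hj | hj <;> rw [hj] at this
  · exact this.symm
  · exact this

lemma singleton_ne {S : Finset V} (hcard : 2 ≤ S.card) (x : V) : ({x} : Finset V) ≠ S := by
  rintro rfl; simp at hcard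

lemma Inst.cut_singleton (h : Inst U z g b) (hcard : 2 ≤ (U.erase z).card) {x : V}
    (hx : x ∈ U.erase z) : 4 + dist0 (b x) ≤ cutDeg g {x} := by
  have := h.cut {x} (by simpa using hx) (by simp) (singleton_ne hcard x)
  simpa using this

/-- If every neighbour of `x` were the root, the disjoint cuts of `x` and of the other non-root
vertices, with at least 4 edges each, would fit among the at most 7 edges at the root. -/
lemma exists_inner_joins (h : Inst U z g b) (hcard : 2 ≤ (U.erase z).card) {x : V}
    (hx : x ∈ U.erase z) : ∃ e y, Joins g e x y ∧ x ≠ y ∧ y ∈ U.erase z := by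
  by_contra! hno
  have hxz : x ≠ z := Finset.ne_of_mem_erase hx
  have hc := Finset.card_erase_of_mem hx
  have h1 := h.cut_singleton hcard hx
  have h2 := h.cut ((U.erase z).erase x) (Finset.erase_subset _ _)
    (Finset.card_pos.1 (by omega))
    (fun h => Finset.notMem_erase x (U.erase z) (by rw [h]; exact hx))
  have h3 := h.rootDeg
  have h4 := dist0_le_three (b z)
  have key : cutDeg g {x} + cutDeg g ((U.erase z).erase x) ≤ cutDeg g {z} := by
    unfold cutDeg
    rw [← Finset.sum_add_distrib]
    refine Finset.sum_le_sum fun e _ => ?_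
    by_cases hce : crosses (g e) {x} = 1
    · obtain ⟨y, hyx, hj⟩ := exists_joins hce
      have hyz : y = z := by
        by_contra hyz
        exact hno e y hj hyx.symm (Finset.mem_erase.2 ⟨hyz, (hj.mem h).2⟩)
      rw [hyz] at hj
      rcases hj with hj | hj <;> simp [crosses, hj, hxz, hxz.symm]
    · have k1 := (h.ends e).1
      have k2 := (h.ends e).2
      simp only [crosses, Finset.mem_singleton, Finset.mem_erase, k1, k2] at hce ⊢
      by_cases a1 : (g e).1 = z <;> by_cases a2 : (g e).1 = x <;>
        by_cases a3 : (g e).2 = z <;> by_cases a4 : (g e).2 = x <;>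
        simp_all
  omega

/-- The vertex is tight, with positive boundary. -/
def IsPlus (g : E → V × V) (b : V → ZMod 6) (x : V) : Prop :=
  b x = 1 ∧ cutDeg g {x} = 5 ∨ b x = 2 ∧ cutDeg g {x} = 6

lemma IsPlus.goodOut {x : V} (h : IsPlus g b x) : 5 + dist0 (b x - 1) ≤ cutDeg g {x} := by
  rcases h with ⟨h1, h2⟩ | ⟨h1, h2⟩ <;> rw [h1, h2] <;> decide

lemma IsPlus.turn {x : V} (h : IsPlus g b x) : 4 + dist0 (b x + 4) ≤ cutDeg g {x} := by
  rcases h with ⟨h1, h2⟩ | ⟨h1, h2⟩ <;> rw [h1, h2] <;> decide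

/-- An arc from `x` into the root could be deleted, so all root arcs leave the root. With fewer than
five of them the root can take over the tail of an inner arc. With exactly five, turning one arc and
absorbing another gives the root degree 6 and boundary 5 - 3 = 2, again tight. -/
lemma sol_of_forall_isPlus (h : Inst U z g b) (hs : Slack U z g b) (ih : SmallerSolvable U z g)
    (hcard : 2 ≤ (U.erase z).card) (hplus : ∀ x ∈ U.erase z, IsPlus g b x) : Sol z g b := by
  by_contra hns
  have hout : ∀ e x, x ≠ z → g e ≠ (x, z) := by
    intro e x hxz hg
    have hxU : x ∈ U := by have := (h.ends e).1; rwa [hg] at this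
    have hx := hplus x (Finset.mem_erase.2 ⟨hxz, hxU⟩)
    exact hns (sol_of_delete h hs ih hg hxz (fun _ => hx.goodOut) (fun h => absurd rfl h))
  have hbz : b z = (cutDeg g {z} : ZMod 6) := by
    rw [h.root]
    unfold flux cutDeg
    push_cast
    refine Finset.sum_congr rfl fun e _ => ?_
    by_cases a1 : (g e).1 = z <;> by_cases a2 : (g e).2 = z
    · simp [arcOn, crosses, a1, a2]
    · simp [arcOn, crosses, a1, a2]
    · exact absurd (show g e = ((g e).1, z) from Prod.ext rfl a2) (hout e _ a1)
    · simp [arcOn, crosses, a1, a2]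
  have hk := h.rootDeg
  -- The bound `k ≤ 4 + dist0 k` fails for 6 and 7, which are 0 and 1 modulo 6.
  have hk5 : cutDeg g {z} ≤ 5 := by
    rw [hbz] at hk
    generalize cutDeg g {z} = k at *
    have : k ≤ 7 := by have := dist0_le_three (k : ZMod 6); omega
    interval_cases k <;> first | omega | (revert hk; decide)
  rcases hk5.lt_or_eq with hk4 | hk5
  · obtain ⟨x, hx⟩ : (U.erase z).Nonempty := Finset.card_pos.1 (by omega)
    obtain ⟨e, y, hj, hxy, hy⟩ := exists_inner_joins h hcard hx
    refine hns (sol_of_move_joins h hs ih hj hxy (Finset.ne_of_mem_erase hx)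
      (Finset.ne_of_mem_erase hy) (hplus x hx).goodOut ?_)
    rw [hbz]
    generalize cutDeg g {z} = k at *
    interval_cases k <;> decide
  · obtain ⟨e, he⟩ := exists_crosses_of_cutDeg_pos (g := g) (A := {z}) (by omega)
    obtain ⟨x, hxz, hj⟩ := exists_joins he
    rcases hj with hj | hj
    · exact hout e x hxz hj
    · have hx : x ∈ U.erase z := Finset.mem_erase.2 ⟨hxz, by
        have := (h.ends e).2; rwa [hj] at this⟩
      obtain ⟨e', y, hj', hxy, hy⟩ := exists_inner_joins h hcard hx
      refine hns (sol_of_turn_joins h hs ih hj hj' hxy hxz (Finset.ne_of_mem_erase hy)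
        (hplus x hx).turn (hplus y hy).goodOut ?_)
      rw [hbz, hk5]; decide

/-- The vertex is tight, with negative boundary. -/
def IsMinus (g : E → V × V) (b : V → ZMod 6) (x : V) : Prop :=
  b x = 5 ∧ cutDeg g {x} = 5 ∨ b x = 4 ∧ cutDeg g {x} = 6

lemma IsMinus.goodIn {x : V} (h : IsMinus g b x) : 5 + dist0 (b x + 1) ≤ cutDeg g {x} := by
  rcases h with ⟨h1, h2⟩ | ⟨h1, h2⟩ <;> rw [h1, h2] <;> decide

lemma IsMinus.reverse {x : V} (h : IsMinus g b x) :
    IsPlus (fun e => (g e).swap) (fun v => -b v) x := by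
  unfold IsPlus
  rw [cutDeg_swap]
  change -b x = 1 ∧ _ ∨ -b x = 2 ∧ _
  rcases h with ⟨h1, h2⟩ | ⟨h1, h2⟩ <;> rw [h1, h2] <;> decide

/-- A vertex able to spare arcs in both directions has an inner neighbour, and that neighbour can
spare the joining edge in at least one direction. -/
lemma isPlus_or_isMinus (h : Inst U z g b) (hs : Slack U z g b) (ih : SmallerSolvable U z g)
    (hcard : 2 ≤ (U.erase z).card) (hns : ¬ Sol z g b) {x : V} (hx : x ∈ U.erase z) :
    IsPlus g b x ∨ IsMinus g b x := by
  have htype : ∀ y ∈ U.erase z,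
      (5 + dist0 (b y - 1) ≤ cutDeg g {y} ∧ 5 + dist0 (b y + 1) ≤ cutDeg g {y}) ∨
        IsPlus g b y ∨ IsMinus g b y := by
    intro y hy
    have hp := h.par_sum {y}
    rw [Finset.sum_singleton] at hp
    rcases vertex_type hp (h.cut_singleton hcard hy) with k | k | k | k
    · exact Or.inl k
    · exact Or.inr (Or.inl k)
    · exact Or.inr (Or.inr k)
    · exact absurd (sol_of_degree_four h hs ih hy k.1 k.2 hcard) hns
  refine (htype x hx).resolve_left fun ⟨ho, hi⟩ => hns ?_
  have hxz : x ≠ z := Finset.ne_of_mem_erase hx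
  obtain ⟨e, y, hj, hxy, hy⟩ := exists_inner_joins h hcard hx
  have hyz : y ≠ z := Finset.ne_of_mem_erase hy
  rcases htype y hy with k | k | k
  · exact sol_of_delete_joins h hs ih hj hxy hxz hyz ho k.2
  · exact sol_of_delete_joins h hs ih hj.symm hxy.symm hyz hxz k.goodOut hi
  · exact sol_of_delete_joins h hs ih hj hxy hxz hyz ho k.goodIn

/-- An edge between the two kinds could be deleted, so all edges leaving either class go to the
root. Each class has a cut of at least 4, but the root has degree at most 7. -/
lemma forall_isPlus_or_forall_isMinus (h : Inst U z g b) (hs : Slack U z g b)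
    (ih : SmallerSolvable U z g) (hcard : 2 ≤ (U.erase z).card) (hns : ¬ Sol z g b) :
    (∀ x ∈ U.erase z, IsPlus g b x) ∨ ∀ x ∈ U.erase z, IsMinus g b x := by
  classical
  have hpm := fun x => isPlus_or_isMinus h hs ih hcard hns (x := x)
  have hexcl : ∀ x, IsPlus g b x → ¬ IsMinus g b x := by
    intro x h1 h2
    rcases h1 with h1 | h1 <;> rcases h2 with h2 | h2 <;>
      have := h1.1.symm.trans h2.1 <;> revert this <;> decide
  by_contra! hboth
  obtain ⟨⟨q, hq, hq'⟩, p, hp, hp'⟩ := hboth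
  have hpp := (hpm p hp).resolve_right hp'
  have hqq := (hpm q hq).resolve_left hq'
  set A := (U.erase z).filter (IsPlus g b) with hA
  set B := (U.erase z).filter (IsMinus g b) with hB
  have hpA : p ∈ A := Finset.mem_filter.2 ⟨hp, hpp⟩
  have hqB : q ∈ B := Finset.mem_filter.2 ⟨hq, hqq⟩
  have hA4 := h.cut A (Finset.filter_subset _ _) ⟨p, hpA⟩
    (fun k => hq' (Finset.mem_filter.1 (show q ∈ A by rw [k]; exact hq)).2)
  have hB4 := h.cut B (Finset.filter_subset _ _) ⟨q, hqB⟩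
    (fun k => hp' (Finset.mem_filter.1 (show p ∈ B by rw [k]; exact hp)).2)
  have h3 := h.rootDeg
  have h4 := dist0_le_three (b z)
  have hno : ∀ e x y, x ∈ A → y ∈ B → ¬ Joins g e x y := by
    intro e x y hx hy hj
    have hx' := Finset.mem_filter.1 hx
    have hy' := Finset.mem_filter.1 hy
    refine hns (sol_of_delete_joins h hs ih hj ?_ (Finset.ne_of_mem_erase hx'.1)
      (Finset.ne_of_mem_erase hy'.1) hx'.2.goodOut hy'.2.goodIn)
    rintro rfl
    exact hexcl x hx'.2 hy'.2
  have hcov : ∀ v ∈ U, (v = z ∧ v ∉ A ∧ v ∉ B) ∨ (v ≠ z ∧ v ∈ A ∧ v ∉ B) ∨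
      (v ≠ z ∧ v ∉ A ∧ v ∈ B) := by
    intro v hv
    by_cases hvz : v = z
    · left; simp [hA, hB, hvz]
    · have hvS : v ∈ U.erase z := Finset.mem_erase.2 ⟨hvz, hv⟩
      right
      rcases hpm v hvS with k | k
      · left
        exact ⟨hvz, Finset.mem_filter.2 ⟨hvS, k⟩,
          fun hvB => hexcl v k (Finset.mem_filter.1 hvB).2⟩
      · right
        exact ⟨hvz, fun hvA => hexcl v (Finset.mem_filter.1 hvA).2 k,
          Finset.mem_filter.2 ⟨hvS, k⟩⟩
  have key : cutDeg g A + cutDeg g B ≤ cutDeg g {z} := by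
    unfold cutDeg
    rw [← Finset.sum_add_distrib]
    refine Finset.sum_le_sum fun e _ => ?_
    have j1 : (g e).1 ∈ A → (g e).2 ∈ B → False := fun a1 a2 => hno e _ _ a1 a2 (Or.inr rfl)
    have j2 : (g e).2 ∈ A → (g e).1 ∈ B → False := fun a1 a2 => hno e _ _ a1 a2 (Or.inl rfl)
    have hzA : z ∉ A := by simp [hA]
    have hzB : z ∉ B := by simp [hB]
    simp only [crosses, Finset.mem_singleton]
    rcases hcov _ (h.ends e).1 with ⟨k1, k2, k3⟩ | ⟨k1, k2, k3⟩ | ⟨k1, k2, k3⟩ <;>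
      rcases hcov _ (h.ends e).2 with ⟨l1, l2, l3⟩ | ⟨l1, l2, l3⟩ | ⟨l1, l2, l3⟩ <;>
      first
      | exact (j1 k2 l3).elim
      | exact (j2 l2 k3).elim
      | simp only [k1, k2, k3, l1, l2, l3]; simp [hzA, hzB]
  omega

lemma sol_of_smaller (h : Inst U z g b) (ih : SmallerSolvable U z g) : Sol z g b := by
  by_contra hns
  have hcard : 2 ≤ (U.erase z).card := by
    by_contra hc
    exact hns (sol_of_card_le_one h (by omega))
  have hs : Slack U z g b := fun A hA h2 hA' => by
    refine slack_of_ne (h.par_sum A) (h.cut A hA (Finset.card_pos.1 (by omega)) hA') fun ht => ?_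
    exact hns (sol_of_tight h ih hA h2 hA' ht)
  rcases forall_isPlus_or_forall_isMinus h hs ih hcard hns with hp | hm
  · exact hns (sol_of_forall_isPlus h hs ih hcard hp)
  · refine hns (Sol.of_reverse (sol_of_forall_isPlus h.reverse ?_ ?_ hcard
      fun x hx => (hm x hx).reverse))
    · intro A h1 h2 h3
      rw [cutDeg_swap, Finset.sum_neg_distrib, dist0_neg]
      exact hs A h1 h2 h3
    · intro U' g' b' hlt
      rw [size_swap] at hlt
      exact ih U' g' b' hlt

/-- Every rooted orientation problem satisfying the degree conditions is solvable. -/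
theorem sol_of_inst (h : Inst U z g b) : Sol z g b := by
  induction hn : size U z g using Nat.strong_induction_on generalizing U g b with
  | _ n ih =>
    subst hn
    exact sol_of_smaller h fun U' g' b' hlt h' => ih _ hlt h' rfl

end ModThree

namespace ModThree

/-! ### Attaching a root to an unrooted graph -/

variable {V E : Type*} [DecidableEq V] [Fintype V] [Fintype E] [DecidableEq E]
  {U : Finset V} {g : E → V × V}

/-- The arcs can be reversed so that all boundaries vanish modulo 3. -/
def Balanced (g : E → V × V) : Prop :=
  ∃ σ : E → ZMod 3, (∀ e, σ e = 1 ∨ σ e = -1) ∧ ∀ v, flux g σ {v} = 0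

/-- Add a new vertex `none` with `mp v` arcs to and `mn v` arcs from each vertex `v`. -/
def attach (g : E → V × V) (mp mn : V → ℕ) :
    E ⊕ ((Σ v, Fin (mp v)) ⊕ (Σ v, Fin (mn v))) → Option V × Option V
  | .inl e => (some (g e).1, some (g e).2)
  | .inr (.inl i) => (none, some i.1)
  | .inr (.inr i) => (some i.1, none)

/-- Weight 3 on old arcs and weight 1 on new arcs. -/
def attachWeight (mp mn : V → ℕ) : E ⊕ ((Σ v, Fin (mp v)) ⊕ (Σ v, Fin (mn v))) → ZMod 6
  | .inl _ => 3
  | .inr _ => 1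

lemma sum_sigma_fin {M : Type*} [CommSemiring M] (m : V → ℕ) (F : V → M) :
    ∑ i : (Σ v, Fin (m v)), F i.1 = ∑ v, (m v : M) * F v := by
  rw [Fintype.sum_sigma]; simp

lemma cutDeg_attach (mp mn : V → ℕ) {A : Finset (Option V)} (hA : none ∉ A) :
    cutDeg (attach g mp mn) A
      = cutDeg g A.eraseNone + (∑ v ∈ A.eraseNone, mp v + ∑ v ∈ A.eraseNone, mn v) := by
  unfold cutDeg
  rw [Fintype.sum_sum_type, Fintype.sum_sum_type]
  congr 1
  · exact Finset.sum_congr rfl fun e _ => by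
      by_cases h1 : some (g e).1 ∈ A <;> by_cases h2 : some (g e).2 ∈ A <;>
        simp [attach, crosses, h1, h2]
  · congr 1
    · refine (sum_sigma_fin mp fun v => crosses (none, some v) A).trans ?_
      rw [← Finset.sum_filter_add_sum_filter_not Finset.univ (fun v => some v ∈ A)]
      rw [Finset.sum_eq_zero (s := Finset.univ.filter fun v => ¬ some v ∈ A), add_zero]
      · refine Finset.sum_congr (by ext; simp) fun v hv => ?_
        have : some v ∈ A := by simpa using hv
        simp [crosses, hA, this]
      · intro v hv
        have : some v ∉ A := by simpa using hv
        simp [crosses, hA, this]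
    · refine (sum_sigma_fin mn fun v => crosses (some v, none) A).trans ?_
      rw [← Finset.sum_filter_add_sum_filter_not Finset.univ (fun v => some v ∈ A)]
      rw [Finset.sum_eq_zero (s := Finset.univ.filter fun v => ¬ some v ∈ A), add_zero]
      · refine Finset.sum_congr (by ext; simp) fun v hv => ?_
        have : some v ∈ A := by simpa using hv
        simp [crosses, hA, this]
      · intro v hv
        have : some v ∉ A := by simpa using hv
        simp [crosses, hA, this]

lemma flux_attach (mp mn : V → ℕ) {A : Finset (Option V)} (hA : none ∉ A)
    (τ : E ⊕ ((Σ v, Fin (mp v)) ⊕ (Σ v, Fin (mn v))) → ZMod 6) (hτ : ∀ i, τ (.inr i) = 1) :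
    flux (attach g mp mn) τ A
      = flux g (fun e => τ (.inl e)) A.eraseNone
        + (- ∑ v ∈ A.eraseNone, (mp v : ZMod 6) + ∑ v ∈ A.eraseNone, (mn v : ZMod 6)) := by
  unfold flux
  rw [Fintype.sum_sum_type, Fintype.sum_sum_type]
  congr 1
  · exact Finset.sum_congr rfl fun e _ => by
      by_cases h1 : some (g e).1 ∈ A <;> by_cases h2 : some (g e).2 ∈ A <;>
        simp [attach, arcOn, h1, h2]
  · simp only [hτ, one_mul]
    congr 1
    · refine (sum_sigma_fin mp fun v => arcOn (ZMod 6) (none, some v) A).trans ?_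
      rw [← Finset.sum_filter_add_sum_filter_not Finset.univ (fun v => some v ∈ A)]
      rw [Finset.sum_eq_zero (s := Finset.univ.filter fun v => ¬ some v ∈ A), add_zero,
        ← Finset.sum_neg_distrib]
      · refine Finset.sum_congr (by ext; simp) fun v hv => ?_
        have : some v ∈ A := by simpa using hv
        simp [arcOn, hA, this]
      · intro v hv
        have : some v ∉ A := by simpa using hv
        simp [arcOn, hA, this]
    · refine (sum_sigma_fin mn fun v => arcOn (ZMod 6) (some v, none) A).trans ?_
      rw [← Finset.sum_filter_add_sum_filter_not Finset.univ (fun v => some v ∈ A)]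
      rw [Finset.sum_eq_zero (s := Finset.univ.filter fun v => ¬ some v ∈ A), add_zero]
      · refine Finset.sum_congr (by ext; simp) fun v hv => ?_
        have : some v ∈ A := by simpa using hv
        simp [arcOn, hA, this]
      · intro v hv
        have : some v ∉ A := by simpa using hv
        simp [arcOn, hA, this]

lemma flux_attach_none (mp mn : V → ℕ)
    (τ : E ⊕ ((Σ v, Fin (mp v)) ⊕ (Σ v, Fin (mn v))) → ZMod 6) (hτ : ∀ i, τ (.inr i) = 1) :
    flux (attach g mp mn) τ {none}
      = ((∑ v, mp v : ℕ) : ZMod 6) - ((∑ v, mn v : ℕ) : ZMod 6) := by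
  unfold flux
  rw [Fintype.sum_sum_type, Fintype.sum_sum_type]
  simp [attach, arcOn, hτ, sub_eq_add_neg]

lemma cutDeg_attach_none (mp mn : V → ℕ) :
    cutDeg (attach g mp mn) {none} = ∑ v, mp v + ∑ v, mn v := by
  unfold cutDeg
  rw [Fintype.sum_sum_type, Fintype.sum_sum_type]
  simp [attach, crosses]

lemma map_flux {R S : Type*} [Ring R] [Ring S] (φ : R →+* S) (g : E → V × V) (σ : E → R)
    (A : Finset V) : φ (flux g σ A) = flux g (fun e => φ (σ e)) A := by
  unfold flux arcOn
  rw [map_sum]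
  refine Finset.sum_congr rfl fun e _ => ?_
  rw [map_mul, map_sub]
  congr 1
  split_ifs <;> simp

lemma flux_const (g : E → V × V) (c : ZMod 6) (A : Finset V) :
    flux g (fun _ => c) A = c * flux g 1 A := by
  simp [flux, Finset.mul_sum]

/-- Here `d` counts old edges and `a`, `c` new arcs of the two directions. The total 7 always
suffices; below it the bad cases are those excluded by the hypotheses, such as `d = 3`, `a = c = 1`,
where the boundary is 3 but the degree only 5. -/
lemma attach_degree {d a c : ℕ} (h3 : 3 ≤ d) (hd3 : d = 3 → 2 ≤ a + c ∧ ¬ (a = 1 ∧ c = 1))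
    (hd5 : d = 5 → 1 ≤ a + c) :
    4 + dist0 (3 * (d : ZMod 6) + (-(a : ZMod 6) + (c : ZMod 6))) ≤ d + (a + c) := by
  have h := dist0_le_three (3 * (d : ZMod 6) + (-(a : ZMod 6) + (c : ZMod 6)))
  by_cases hlt : 7 ≤ d + (a + c)
  · omega
  · have hd : d ≤ 6 := by omega
    have ha : a ≤ 3 := by omega
    have hc : c ≤ 3 := by omega
    clear h
    interval_cases d <;> interval_cases a <;> interval_cases c <;>
      first | omega | decide

/-- The boundary is the outflow with weight 3 on old arcs: it has the right parity and asks the old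
arcs for outflow 0 modulo 3. -/
lemma balanced_of_attach (hends : ∀ e, (g e).1 ∈ U ∧ (g e).2 ∈ U) (mp mn : V → ℕ)
    (hmp : ∀ v, v ∉ U → mp v = 0) (hmn : ∀ v, v ∉ U → mn v = 0)
    (hn : ∑ v, mn v = 2) (hp : ∑ v, mp v ≤ 5)
    (hcut : ∀ A ⊆ U, A.Nonempty → A ≠ U → 3 ≤ cutDeg g A ∧
      (cutDeg g A = 3 → 2 ≤ ∑ v ∈ A, mp v + ∑ v ∈ A, mn v ∧
        ¬ (∑ v ∈ A, mp v = 1 ∧ ∑ v ∈ A, mn v = 1)) ∧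
      (cutDeg g A = 5 → 1 ≤ ∑ v ∈ A, mp v + ∑ v ∈ A, mn v)) : Balanced g := by
  set ω := attachWeight (E := E) mp mn with hω
  have hω1 : ∀ i, ω (.inr i) = 1 := fun _ => rfl
  have hinst : Inst (Finset.insertNone U) none (attach g mp mn)
      (fun w => flux (attach g mp mn) ω {w}) := by
    have hends' : ∀ e, (attach g mp mn e).1 ∈ Finset.insertNone U ∧
        (attach g mp mn e).2 ∈ Finset.insertNone U := by
      rintro (e | ⟨v, i⟩ | ⟨v, i⟩)
      · simpa [attach] using hends e
      · have : v ∈ U := by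
          by_contra hv
          exact absurd i.pos (by rw [hmp v hv]; simp)
        simpa [attach] using this
      · have : v ∈ U := by
          by_contra hv
          exact absurd i.pos (by rw [hmn v hv]; simp)
        simpa [attach] using this
    refine ⟨Finset.none_mem_insertNone, hends', fun v hv => flux_eq_zero_of_ends hends' ω hv, ?_,
      fun v => ?_, ?_, ?_, fun A h1 h2 h3 => ?_⟩
    · rw [sum_flux, flux_univ]
    · simp only [flux, Finset.mul_sum]
      refine Finset.sum_congr rfl fun e _ => ?_
      have : (3 : ZMod 6) * ω e = 3 := by
        rcases e with e | i
        · change (3 : ZMod 6) * 3 = 3; decide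
        · change (3 : ZMod 6) * 1 = 3; decide
      rw [← mul_assoc, this]; simp
    · rw [flux_attach_none _ _ _ hω1, flux_attach_none _ _ _ fun _ => rfl]
    · rw [flux_attach_none _ _ _ hω1, cutDeg_attach_none, hn]
      -- The root has degree `k + 2` and outflow `k - 2`; the degree bound holds for all `k ≤ 5`,
      -- with `k = 5` giving 7 = 4 + 3.
      generalize ∑ v, mp v = k at hp
      interval_cases k <;> decide
    · have hnone : none ∉ A := fun h => by simpa using h1 h
      have hAU : A.eraseNone ⊆ U := fun v hv => by
        have := h1 (Finset.mem_eraseNone.1 hv)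
        simpa using this
      obtain ⟨k1, k2, k3⟩ := hcut A.eraseNone hAU (by
          obtain ⟨w, hw⟩ := h2
          cases w with
          | none => exact absurd hw hnone
          | some v => exact ⟨v, Finset.mem_eraseNone.2 hw⟩) (fun hU => h3 (by
          refine Finset.Subset.antisymm h1 fun w hw => ?_
          cases w with
          | none => simp at hw
          | some v =>
            have : v ∈ A.eraseNone := by rw [hU]; simpa using hw
            exact Finset.mem_eraseNone.1 this))
      rw [sum_flux, flux_attach _ _ hnone _ hω1, cutDeg_attach _ _ hnone]
      have : (fun e => ω (Sum.inl e)) = fun _ : E => (3 : ZMod 6) := rfl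
      rw [this, flux_const, three_mul_flux]
      have := attach_degree k1 k2 k3
      push_cast at this
      exact this
  obtain ⟨σ, h1, h2, h3⟩ := sol_of_inst hinst
  have hσ : ∀ i, σ (.inr i) = 1 := by
    rintro (i | i)
    · exact h2 _ (Or.inl rfl)
    · exact h2 _ (Or.inr rfl)
  let φ : ZMod 6 →+* ZMod 3 := ZMod.castHom (by decide) _
  refine ⟨fun e => φ (σ (.inl e)), fun e => ?_, fun v => ?_⟩
  · rcases h1 (.inl e) with h | h <;> simp [h]
  · have : flux (attach g mp mn) σ {some v} = flux (attach g mp mn) ω {some v} := h3 (some v)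
    rw [flux_attach _ _ (by simp) _ hσ, flux_attach _ _ (by simp) _ hω1] at this
    have h4 := add_right_cancel this
    have : (fun e => ω (Sum.inl e)) = fun _ : E => (3 : ZMod 6) := rfl
    rw [this, flux_const] at h4
    have h5 : ({some v} : Finset (Option V)).eraseNone = {v} := by ext; simp
    rw [h5] at h4
    rw [← map_flux, h4, map_mul]
    have : φ 3 = 0 := by decide
    rw [this, zero_mul]

end ModThree

namespace ModThree

/-! ### Distributing the new arcs over the odd cuts -/

variable {V E : Type*} [DecidableEq V] [Fintype V] [Fintype E] [DecidableEq E]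
  {U : Finset V} {g : E → V × V}

/-- The set of edges crossing a vertex set. -/
def cutSet (g : E → V × V) (A : Finset V) : Finset E :=
  Finset.univ.filter fun e => crosses (g e) A = 1

lemma card_cutSet (g : E → V × V) (A : Finset V) : (cutSet g A).card = cutDeg g A :=
  (cutDeg_eq_card g A).symm

open Classical in
/-- The edge cuts with `k` edges. -/
noncomputable def cuts (g : E → V × V) (k : ℕ) : Finset (Finset E) :=
  Finset.univ.filter fun C => C.card = k ∧ ∃ A, C = cutSet g A

lemma mem_cuts {k : ℕ} {C : Finset E} : C ∈ cuts g k ↔ C.card = k ∧ ∃ A, C = cutSet g A := by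
  simp [cuts]

lemma cutSet_mem_cuts {k : ℕ} {A : Finset V} : cutSet g A ∈ cuts g k ↔ cutDeg g A = k := by
  rw [mem_cuts, card_cutSet]
  exact ⟨fun h => h.1, fun h => ⟨h, A, rfl⟩⟩

lemma cutSet_inter (hends : ∀ e, (g e).1 ∈ U ∧ (g e).2 ∈ U) (A : Finset V) :
    cutSet g (A ∩ U) = cutSet g A := by
  unfold cutSet crosses
  ext e
  have := hends e
  simp [this.1, this.2]

lemma cutSet_sdiff (hends : ∀ e, (g e).1 ∈ U ∧ (g e).2 ∈ U) (A : Finset V) :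
    cutSet g (U \ A) = cutSet g A := by
  unfold cutSet crosses
  ext e
  have := hends e
  simp [this.1, this.2, not_iff_not]

/-- All vertex sets of a graph on `U` have cuts with at least three edges. -/
def ThreeConn (U : Finset V) (g : E → V × V) : Prop :=
  ∀ A ⊆ U, A.Nonempty → A ≠ U → 3 ≤ cutDeg g A

/-- The symmetric difference of the two sets has an empty cut and misses `r`, so it is empty. -/
lemma eq_of_cutSet_eq (hc : ThreeConn U g) {r : V} (hr : r ∈ U) {A B : Finset V} (hA : A ⊆ U)
    (hB : B ⊆ U) (hrA : r ∉ A) (hrB : r ∉ B) (h : cutSet g A = cutSet g B) : A = B := by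
  by_contra hne
  have h3 := hc (symmDiff A B) (fun v hv => by
      rcases Finset.mem_symmDiff.1 hv with h | h
      · exact hA h.1
      · exact hB h.1)
    (by rw [Finset.nonempty_iff_ne_empty]; exact fun h => hne (symmDiff_eq_bot.1 h))
    (fun h' => by
      have : r ∈ symmDiff A B := by rw [h']; exact hr
      simp [Finset.mem_symmDiff, hrA, hrB] at this)
  have h0 : cutDeg g (symmDiff A B) = 0 := by
    refine Finset.sum_eq_zero fun e _ => ?_
    have : e ∈ cutSet g A ↔ e ∈ cutSet g B := by rw [h]
    simp only [cutSet, crosses] at this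
    simp only [crosses, Finset.mem_symmDiff]
    by_cases a1 : (g e).1 ∈ A <;> by_cases a2 : (g e).2 ∈ A <;>
      by_cases a3 : (g e).1 ∈ B <;> by_cases a4 : (g e).2 ∈ B <;> simp_all
  omega

/-- A cut determines its side avoiding `r`, so a vertex of that side can be chosen as a function of
the edge set alone. -/
lemma exists_representative (hends : ∀ e, (g e).1 ∈ U ∧ (g e).2 ∈ U) (hc : ThreeConn U g) {r : V}
    (hr : r ∈ U) : ∃ h : Finset E → V,
      (∀ A ⊆ U, A.Nonempty → r ∉ A → h (cutSet g A) ∈ A) ∧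
      ∀ k, 0 < k → ∀ C ∈ cuts g k, h C ∈ U ∧ h C ≠ r := by
  classical
  let h : Finset E → V := fun C =>
    if hC : ∃ v, ∃ A ⊆ U, v ∈ A ∧ r ∉ A ∧ cutSet g A = C then hC.choose else r
  have h1 : ∀ A ⊆ U, A.Nonempty → r ∉ A → h (cutSet g A) ∈ A := by
    intro A hA ⟨v, hv⟩ hrA
    have hex : ∃ v, ∃ A' ⊆ U, v ∈ A' ∧ r ∉ A' ∧ cutSet g A' = cutSet g A :=
      ⟨v, A, hA, hv, hrA, rfl⟩
    simp only [h, dif_pos hex]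
    obtain ⟨B, hB, hvB, hrB, hBA⟩ := hex.choose_spec
    rwa [eq_of_cutSet_eq hc hr hB hA hrB hrA hBA] at hvB
  refine ⟨h, h1, fun k hk C hC => ?_⟩
  obtain ⟨hCk, A, rfl⟩ := mem_cuts.1 hC
  obtain ⟨B, hB, hrB, hBA⟩ : ∃ B ⊆ U, r ∉ B ∧ cutSet g B = cutSet g A := by
    by_cases hrA : r ∈ A
    · exact ⟨U \ A, Finset.sdiff_subset, by simp [hrA], cutSet_sdiff hends A⟩
    · exact ⟨A ∩ U, Finset.inter_subset_right, by simp [hrA], cutSet_inter hends A⟩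
  have hBne : B.Nonempty := by
    rw [Finset.nonempty_iff_ne_empty]
    rintro rfl
    rw [← hBA, card_cutSet] at hCk
    simp [cutDeg, crosses] at hCk
    omega
  have := h1 B hB hBne hrB
  rw [hBA] at this
  exact ⟨hB this, fun h' => hrB (h' ▸ this)⟩

lemma exists_split_seven {H : Finset V} (hH : H ⊆ U) (hU : U.Nonempty) (h7 : H.card ≤ 7) :
    ∃ H' ⊆ U, ∃ c ∈ U, ∃ d ∈ U, H'.card ≤ 5 ∧ ∀ v ∈ H, v ∈ H' ∨ v = c ∨ v = d := by
  by_cases h5 : H.card ≤ 5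
  · obtain ⟨r, hr⟩ := hU
    exact ⟨H, hH, r, hr, r, hr, h5, fun v hv => Or.inl hv⟩
  · obtain ⟨c, hc, d, hd, hcd⟩ := Finset.one_lt_card.1 (show 1 < H.card by omega)
    refine ⟨(H.erase c).erase d, ((Finset.erase_subset _ _).trans (Finset.erase_subset _ _)).trans
      hH, c, hH hc, d, hH hd, ?_, fun v hv => ?_⟩
    · rw [Finset.card_erase_of_mem (Finset.mem_erase.2 ⟨hcd.symm, hd⟩),
        Finset.card_erase_of_mem hc]
      omega
    · by_cases h1 : v = c
      · exact Or.inr (Or.inl h1)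
      · by_cases h2 : v = d
        · exact Or.inr (Or.inr h2)
        · exact Or.inl (by simp [h1, h2, hv])

/-- Seven single arcs are enough without 3-cuts: five vertices of `H` receive an arc from the root
and two send one to it. -/
lemma balanced_of_hitting (hends : ∀ e, (g e).1 ∈ U ∧ (g e).2 ∈ U) (hU : U.Nonempty)
    (hc : ThreeConn U g) (h3 : ∀ A, cutDeg g A ≠ 3) {H : Finset V} (hH : H ⊆ U)
    (h7 : H.card ≤ 7)
    (hhit : ∀ A ⊆ U, A.Nonempty → A ≠ U → cutDeg g A = 5 → ∃ v ∈ H, v ∈ A) : Balanced g := by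
  obtain ⟨H', hH', c, hcU, d, hdU, h5, hcov⟩ := exists_split_seven hH hU h7
  refine balanced_of_attach hends (fun v => if v ∈ H' then 1 else 0)
    (fun v => (if v = c then 1 else 0) + (if v = d then 1 else 0)) (fun v hv => ?_)
    (fun v hv => ?_) ?_ ?_ (fun A hA hne hAU => ⟨hc A hA hne hAU, fun h => absurd h (h3 A),
      fun hA5 => ?_⟩)
  · simp only [ite_eq_right_iff, one_ne_zero, imp_false]; exact fun h => hv (hH' h)
  · have h1 : v ≠ c := by rintro rfl; exact hv hcU
    have h2 : v ≠ d := by rintro rfl; exact hv hdU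
    simp [h1, h2]
  · simp [Finset.sum_add_distrib]
  · simpa using h5
  · obtain ⟨v, hvH, hvA⟩ := hhit A hA hne hAU hA5
    rcases hcov v hvH with h | h
    · have := Finset.single_le_sum (f := fun v => if v ∈ H' then 1 else 0)
        (fun _ _ => Nat.zero_le _) hvA
      simp only [h, if_true] at this
      omega
    · have := Finset.single_le_sum
        (f := fun v => (if v = c then 1 else 0) + (if v = d then 1 else 0))
        (fun _ _ => Nat.zero_le _) hvA
      have h1 : 1 ≤ (if v = c then 1 else 0) + (if v = d then 1 else 0) := by
        rcases h with h | h <;> simp [h]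
      omega

/-- Both sides of every 5-cut must be hit by seven vertices. Representatives hit the sides avoiding
`r`, and `r` hits the others; this is one vertex too many only when there are seven cuts. If two
sides avoiding `r` meet, a common vertex replaces two representatives. If they are pairwise
disjoint, `r` is superfluous. -/
lemma balanced_of_no_three (hends : ∀ e, (g e).1 ∈ U ∧ (g e).2 ∈ U) (hU : U.Nonempty)
    (hc : ThreeConn U g) (h3 : ∀ A, cutDeg g A ≠ 3) (h7 : (cuts g 5).card ≤ 7) :
    Balanced g := by
  classical
  obtain ⟨r, hr⟩ := hU
  obtain ⟨h, h1, h2⟩ := exists_representative hends hc hr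
  have himg : ∀ S ⊆ cuts g 5, S.image h ⊆ U := fun S hS v hv => by
    obtain ⟨C, hC, rfl⟩ := Finset.mem_image.1 hv
    exact (h2 5 (by norm_num) C (hS hC)).1
  by_cases hdisj : ∀ A ⊆ U, ∀ B ⊆ U, r ∉ A → r ∉ B → cutDeg g A = 5 → cutDeg g B = 5 →
      A ≠ B → Disjoint A B
  · by_cases h6 : (cuts g 5).card ≤ 6
    · refine balanced_of_hitting hends ⟨r, hr⟩ hc h3 (H := insert r ((cuts g 5).image h))
        (Finset.insert_subset hr (himg _ le_rfl)) ?_ fun A hA hne hAU hA5 => ?_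
      · have k1 := Finset.card_insert_le r ((cuts g 5).image h)
        have k2 := Finset.card_image_le (s := cuts g 5) (f := h)
        omega
      · by_cases hrA : r ∈ A
        · exact ⟨r, by simp, hrA⟩
        · exact ⟨h (cutSet g A), Finset.mem_insert_of_mem
            (Finset.mem_image_of_mem h (cutSet_mem_cuts.2 hA5)), h1 A hA hne hrA⟩
    · refine balanced_of_hitting hends ⟨r, hr⟩ hc h3 (H := (cuts g 5).image h)
        (himg _ le_rfl) ?_ fun A hA hne hAU hA5 => ?_
      · exact Finset.card_image_le.trans h7
      · by_cases hrA : r ∈ A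
        -- The `r`-avoiding side of another 5-cut is disjoint from the complement of `A`, so its
        -- representative lies in `A`.
        · obtain ⟨C, hC, hCA⟩ := Finset.exists_mem_ne (show 1 < (cuts g 5).card by omega)
            (cutSet g A)
          refine ⟨h C, Finset.mem_image_of_mem h hC, ?_⟩
          by_contra hhA
          obtain ⟨hC5, B, rfl⟩ := mem_cuts.1 hC
          obtain ⟨B', hB', hrB', hBB'⟩ : ∃ B' ⊆ U, r ∉ B' ∧ cutSet g B' = cutSet g B := by
            by_cases hrB : r ∈ B
            · exact ⟨U \ B, Finset.sdiff_subset, by simp [hrB], cutSet_sdiff hends B⟩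
            · exact ⟨B ∩ U, Finset.inter_subset_right, by simp [hrB], cutSet_inter hends B⟩
          rw [← hBB'] at hC5 hCA hhA hC
          have hB'ne : B'.Nonempty := by
            rw [Finset.nonempty_iff_ne_empty]
            rintro rfl
            rw [card_cutSet] at hC5
            simp [cutDeg, crosses] at hC5
          have hmem := h1 B' hB' hB'ne hrB'
          have hd := hdisj (U \ A) Finset.sdiff_subset B' hB' (by simp [hrA]) hrB'
            (by rw [← card_cutSet, cutSet_sdiff hends, card_cutSet, hA5])
            (by rw [← card_cutSet, hC5])
            (by rintro rfl; exact hCA (cutSet_sdiff hends A))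
          exact Finset.disjoint_left.1 hd (Finset.mem_sdiff.2 ⟨hB' hmem, hhA⟩) hmem
        · exact ⟨h (cutSet g A), Finset.mem_image_of_mem h (cutSet_mem_cuts.2 hA5),
            h1 A hA hne hrA⟩
  · push Not at hdisj
    obtain ⟨A, hA, B, hB, hrA, hrB, hA5, hB5, hAB, hnd⟩ := hdisj
    obtain ⟨v, hvA, hvB⟩ := Finset.not_disjoint_iff.1 hnd
    have hne : cutSet g A ≠ cutSet g B := fun h' => hAB (eq_of_cutSet_eq hc hr hA hB hrA hrB h')
    set S := ((cuts g 5).erase (cutSet g A)).erase (cutSet g B) with hS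
    have hScard : S.card + 2 ≤ 7 := by
      have hm : cutSet g B ∈ (cuts g 5).erase (cutSet g A) :=
        Finset.mem_erase.2 ⟨hne.symm, cutSet_mem_cuts.2 hB5⟩
      have hm' : cutSet g A ∈ cuts g 5 := cutSet_mem_cuts.2 hA5
      have k1 := Finset.card_erase_add_one hm
      rw [← hS] at k1
      have k2 := Finset.card_erase_add_one hm'
      omega
    refine balanced_of_hitting hends ⟨r, hr⟩ hc h3 (H := insert r (insert v (S.image h)))
      (Finset.insert_subset hr (Finset.insert_subset (hA hvA) (himg _
        ((Finset.erase_subset _ _).trans (Finset.erase_subset _ _))))) ?_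
      fun D hD hDne hDU hD5 => ?_
    · have k1 := Finset.card_insert_le r (insert v (S.image h))
      have k2 := Finset.card_insert_le v (S.image h)
      have k3 := Finset.card_image_le (s := S) (f := h)
      omega
    · by_cases hrD : r ∈ D
      · exact ⟨r, by simp, hrD⟩
      · by_cases hDA : cutSet g D = cutSet g A
        · refine ⟨v, by simp, ?_⟩
          rwa [eq_of_cutSet_eq hc hr hD hA hrD hrA hDA]
        · by_cases hDB : cutSet g D = cutSet g B
          · refine ⟨v, by simp, ?_⟩
            rwa [eq_of_cutSet_eq hc hr hD hB hrD hrB hDB]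
          · refine ⟨h (cutSet g D), ?_, h1 D hD hDne hrD⟩
            refine Finset.mem_insert_of_mem (Finset.mem_insert_of_mem
              (Finset.mem_image_of_mem h ?_))
            exact Finset.mem_erase.2 ⟨hDB, Finset.mem_erase.2 ⟨hDA, cutSet_mem_cuts.2 hD5⟩⟩

/-- Both arcs into the root are placed at `r`, which serves every side containing `r`. The opposite
arcs go to representatives: two for each 3-cut other than that of `r`, one for each 5-cut. -/
lemma balanced_of_three (hends : ∀ e, (g e).1 ∈ U ∧ (g e).2 ∈ U)
    (hc : ThreeConn U g) {r : V} (hr : r ∈ U) (hr3 : cutDeg g {r} = 3)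
    (h7 : 2 * (cuts g 3).card + (cuts g 5).card ≤ 7) : Balanced g := by
  classical
  obtain ⟨h, h1, h2⟩ := exists_representative hends hc hr
  obtain ⟨u, huU, hur⟩ : ∃ u ∈ U, u ≠ r := by
    have := h2 3 (by norm_num) _ (cutSet_mem_cuts.2 hr3)
    exact ⟨_, this⟩
  set S := (cuts g 3).erase (cutSet g {r}) with hS
  have hScard := Finset.card_erase_add_one (cutSet_mem_cuts.2 hr3)
  rw [← hS] at hScard
  set t := 2 * S.card + (cuts g 5).card with ht
  have hmemS : ∀ C ∈ S, h C ∈ U ∧ h C ≠ r :=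
    fun C hC => h2 3 (by norm_num) C (Finset.mem_of_mem_erase hC)
  have hmem5 : ∀ C ∈ cuts g 5, h C ∈ U ∧ h C ≠ r := h2 5 (by norm_num)
  -- The truncated `2 - t` raises the total to at least 2, as the side `U \ {r}` of the remaining
  -- 3-cut needs. Leaving that cut out of `S` gives `t ≤ 5`.
  let mp : V → ℕ := fun v => (∑ C ∈ S, if h C = v then 2 else 0)
    + (∑ C ∈ cuts g 5, if h C = v then 1 else 0) + if u = v then 2 - t else 0
  have hsum : ∀ A : Finset V, ∑ v ∈ A, mp v = (∑ C ∈ S, if h C ∈ A then 2 else 0)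
      + (∑ C ∈ cuts g 5, if h C ∈ A then 1 else 0) + if u ∈ A then 2 - t else 0 := by
    intro A
    simp only [mp, Finset.sum_add_distrib]
    rw [Finset.sum_comm, Finset.sum_comm (s := A) (t := cuts g 5)]
    simp only [Finset.sum_ite_eq]
  have htotal : ∀ A : Finset V, U.erase r ⊆ A → ∑ v ∈ A, mp v = t + (2 - t) := by
    intro A hA
    have k1 : ∀ C ∈ S, h C ∈ A := fun C hC =>
      hA (Finset.mem_erase.2 ⟨(hmemS C hC).2, (hmemS C hC).1⟩)
    have k2 : ∀ C ∈ cuts g 5, h C ∈ A := fun C hC =>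
      hA (Finset.mem_erase.2 ⟨(hmem5 C hC).2, (hmem5 C hC).1⟩)
    have k3 : u ∈ A := hA (Finset.mem_erase.2 ⟨hur, huU⟩)
    rw [hsum, Finset.sum_congr rfl fun C hC => if_pos (k1 C hC),
      Finset.sum_congr rfl fun C hC => if_pos (k2 C hC), if_pos k3, ht]
    simp [mul_comm]
  refine balanced_of_attach hends mp (fun v => if v = r then 2 else 0) (fun v hv => ?_)
    (fun v hv => ?_) (by simp) ?_ fun A hA hne hAU => ⟨hc A hA hne hAU, fun hA3 => ?_,
      fun hA5 => ?_⟩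
  · have k1 : ∀ C ∈ S, h C ≠ v := fun C hC h' => hv (h' ▸ (hmemS C hC).1)
    have k2 : ∀ C ∈ cuts g 5, h C ≠ v := fun C hC h' => hv (h' ▸ (hmem5 C hC).1)
    have k3 : u ≠ v := fun h' => hv (h' ▸ huU)
    simp only [mp]
    rw [Finset.sum_eq_zero fun C hC => if_neg (k1 C hC),
      Finset.sum_eq_zero fun C hC => if_neg (k2 C hC), if_neg k3]
    rfl
  · have : v ≠ r := by rintro rfl; exact hv hr
    simp [this]
  · rw [htotal _ (Finset.subset_univ _)]; omega
  · by_cases hrA : r ∈ A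
    · have : ∑ v ∈ A, (if v = r then 2 else 0) = 2 := by simp [hrA]
      rw [this]; omega
    · have h0 : ∑ v ∈ A, (if v = r then 2 else 0) = 0 := by simp [hrA]
      rw [h0]
      suffices 2 ≤ ∑ v ∈ A, mp v by omega
      by_cases hAr : cutSet g A = cutSet g {r}
      · have hAeq : A = U \ {r} := eq_of_cutSet_eq hc hr hA Finset.sdiff_subset hrA (by simp)
          (hAr.trans (cutSet_sdiff hends {r}).symm)
        rw [htotal A (by rw [hAeq, Finset.sdiff_singleton_eq_erase])]
        omega
      · have hAS : cutSet g A ∈ S := Finset.mem_erase.2 ⟨hAr, cutSet_mem_cuts.2 hA3⟩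
        have := Finset.single_le_sum (f := fun C => if h C ∈ A then 2 else 0)
          (fun _ _ => Nat.zero_le _) hAS
        simp only [h1 A hA hne hrA, if_true] at this
        rw [hsum]; omega
  · by_cases hrA : r ∈ A
    · have : ∑ v ∈ A, (if v = r then 2 else 0) = 2 := by simp [hrA]
      rw [this]; omega
    · have := Finset.single_le_sum (f := fun C => if h C ∈ A then 1 else 0)
        (fun _ _ => Nat.zero_le _) (cutSet_mem_cuts.2 hA5)
      simp only [h1 A hA hne hrA, if_true] at this
      rw [hsum]; omega

end ModThree

namespace ModThree

/-! ### Reduction of small cuts by contraction -/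

variable {V E : Type*} [DecidableEq V] [Fintype V] [Fintype E] [DecidableEq E]
  {U : Finset V} {g : E → V × V}

lemma cutSet_mapArcs (f : V → V) (g : E → V × V) (A : Finset V) :
    cutSet (mapArcs f g) A = cutSet g (pre f A) := by
  ext e
  rw [cutSet, cutSet, Finset.mem_filter, Finset.mem_filter]
  by_cases h1 : f (g e).1 ∈ A <;> by_cases h2 : f (g e).2 ∈ A <;>
    simp [crosses, mapArcs, h1, h2]

lemma cuts_mapArcs_subset (f : V → V) (g : E → V × V) (k : ℕ) :
    cuts (mapArcs f g) k ⊆ cuts g k := by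
  intro C hC
  obtain ⟨h1, A, rfl⟩ := mem_cuts.1 hC
  exact mem_cuts.2 ⟨h1, _, cutSet_mapArcs f g A⟩

/-- No bridges, few cuts with three or five edges. -/
def FewOddCuts (g : E → V × V) : Prop :=
  (∀ A, cutDeg g A ≠ 1) ∧ 2 * (cuts g 3).card + (cuts g 5).card ≤ 7

lemma FewOddCuts.map (h : FewOddCuts g) (f : V → V) : FewOddCuts (mapArcs f g) := by
  refine ⟨fun A => by rw [cutDeg_mapArcs]; exact h.1 _, ?_⟩
  have h3 := Finset.card_le_card (cuts_mapArcs_subset f g 3)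
  have h5 := Finset.card_le_card (cuts_mapArcs_subset f g 5)
  have := h.2
  omega

/-- Identifying `a` with `u` controls only the sum of their outflows. As `A` separates them and has
outflow 0, each of the two vanishes. -/
lemma flux_eq_zero_of_identify {A : Finset V} {a u : V} (ha : a ∈ A) (hu : u ∉ A)
    {σ : E → ZMod 3} (h : ∀ v, flux (mapArcs (collapse {a, u} u) g) σ {v} = 0)
    (hA : flux g σ A = 0) (v : V) : flux g σ {v} = 0 := by
  have hau : a ≠ u := by rintro rfl; exact hu ha
  have hoff : ∀ w, w ≠ a → w ≠ u → flux g σ {w} = 0 := by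
    intro w hwa hwu
    have := h w
    rwa [flux_mapArcs, pre_collapse_of_notMem (by simp) (by simp [hwa, hwu])] at this
  have hpair : flux g σ {a} + flux g σ {u} = 0 := by
    have := h u
    rwa [flux_mapArcs, pre_collapse_self (by simp), ← sum_flux, Finset.sum_pair hau] at this
  have ha0 : flux g σ {a} = 0 := by
    rw [← sum_flux, Finset.sum_eq_single_of_mem a ha] at hA
    · exact hA
    · intro w hw hwa
      exact hoff w hwa (by rintro rfl; exact hu hw)
  by_cases hva : v = a
  · rw [hva, ha0]
  · by_cases hvu : v = u
    · rw [ha0, zero_add] at hpair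
      rw [hvu, hpair]
    · exact hoff v hva hvu

lemma card_image_lt_of_eq {f : V → V} {x y : V} (hx : x ∈ U) (hy : y ∈ U) (hxy : x ≠ y)
    (h : f x = f y) : (U.image f).card < U.card :=
  lt_of_le_of_ne Finset.card_image_le fun hc => hxy (Finset.card_image_iff.1 hc hx hy h)

lemma ends_mapArcs (hends : ∀ e, (g e).1 ∈ U ∧ (g e).2 ∈ U) (f : V → V) (e : E) :
    (mapArcs f g e).1 ∈ U.image f ∧ (mapArcs f g e).2 ∈ U.image f :=
  ⟨Finset.mem_image_of_mem f (hends e).1, Finset.mem_image_of_mem f (hends e).2⟩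

/-- Smaller graphs with few odd cuts are balanced. -/
def SmallerBalanced (E : Type*) [Fintype E] [DecidableEq E] (U : Finset V) : Prop :=
  ∀ (U' : Finset V) (g' : E → V × V), U'.card < U.card →
    (∀ e, (g' e).1 ∈ U' ∧ (g' e).2 ∈ U') → FewOddCuts g' → Balanced g'

lemma balanced_of_cutDeg_zero (hends : ∀ e, (g e).1 ∈ U ∧ (g e).2 ∈ U) (hf : FewOddCuts g)
    (ih : SmallerBalanced E U) {A : Finset V} (hA : A ⊆ U) (hne : A.Nonempty) (hAU : A ≠ U)
    (h0 : cutDeg g A = 0) : Balanced g := by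
  obtain ⟨a, ha⟩ := hne
  obtain ⟨u, huU, hu⟩ := Finset.exists_of_ssubset (Finset.ssubset_iff_subset_ne.2 ⟨hA, hAU⟩)
  have hau : a ≠ u := by rintro rfl; exact hu ha
  obtain ⟨σ, h1, h2⟩ := ih (U.image (collapse {a, u} u)) (mapArcs (collapse {a, u} u) g)
    (card_image_lt_of_eq (hA ha) huU hau (by simp [collapse])) (ends_mapArcs hends _) (hf.map _)
  refine ⟨σ, h1, flux_eq_zero_of_identify ha hu h2 ?_⟩
  refine Finset.sum_eq_zero fun e _ => ?_
  rw [arcOn_eq_zero, mul_zero]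
  exact (Finset.sum_eq_zero_iff.1 h0) e (Finset.mem_univ e)

lemma flux_eq_sum_cutSet (g : E → V × V) (σ : E → ZMod 3) (A : Finset V) :
    flux g σ A = ∑ e ∈ cutSet g A, σ e * arcOn (ZMod 3) (g e) A := by
  refine (Finset.sum_subset (Finset.subset_univ _) fun e _ he => ?_).symm
  rw [arcOn_eq_zero, mul_zero]
  have := crosses_le_one (g e) A
  have : crosses (g e) A ≠ 1 := by simpa [cutSet] using he
  omega

lemma arcOn_of_mem_cutSet {A : Finset V} {e : E} (he : e ∈ cutSet g A) :
    arcOn (ZMod 3) (g e) A = 1 ∨ arcOn (ZMod 3) (g e) A = -1 := by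
  have : crosses (g e) A = 1 := (Finset.mem_filter.1 he).2
  rcases crosses_cases (R := ZMod 3) (g e) A with h | h
  · omega
  · exact h.2

/-- Contract one edge `e` of the cut. It becomes a loop, so its sign is free and can be chosen to
cancel the other edge across `A`. -/
lemma balanced_of_cutDeg_two (hends : ∀ e, (g e).1 ∈ U ∧ (g e).2 ∈ U) (hf : FewOddCuts g)
    (ih : SmallerBalanced E U) {A : Finset V}
    (h2 : cutDeg g A = 2) : Balanced g := by
  rw [← card_cutSet] at h2
  obtain ⟨e, e', hee, hcut⟩ := Finset.card_eq_two.1 h2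
  have he : e ∈ cutSet g A := by rw [hcut]; simp
  have he' : e' ∈ cutSet g A := by rw [hcut]; simp
  obtain ⟨a, u, ha, hu, hau, haU, huU, hj⟩ : ∃ a u, a ∈ A ∧ u ∉ A ∧ a ≠ u ∧ a ∈ U ∧ u ∈ U ∧
      (g e = (a, u) ∨ g e = (u, a)) := by
    have hc : crosses (g e) A = 1 := (Finset.mem_filter.1 he).2
    have hU := hends e
    unfold crosses at hc
    by_cases k1 : (g e).1 ∈ A <;> by_cases k2 : (g e).2 ∈ A
    · simp [k1, k2] at hc
    · exact ⟨_, _, k1, k2, fun h => k2 (h ▸ k1), hU.1, hU.2, Or.inl rfl⟩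
    · exact ⟨_, _, k2, k1, fun h => k1 (h ▸ k2), hU.2, hU.1, Or.inr rfl⟩
    · simp [k1, k2] at hc
  obtain ⟨σ, h1, h3⟩ := ih (U.image (collapse {a, u} u)) (mapArcs (collapse {a, u} u) g)
    (card_image_lt_of_eq haU huU hau (by simp [collapse])) (ends_mapArcs hends _) (hf.map _)
  set s := arcOn (ZMod 3) (g e) A with hs
  set s' := arcOn (ZMod 3) (g e') A with hs'
  have hs1 : s = 1 ∨ s = -1 := arcOn_of_mem_cutSet he
  have hs1' : s' = 1 ∨ s' = -1 := arcOn_of_mem_cutSet he'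
  let τ : E → ZMod 3 := Function.update σ e (-(σ e' * s' * s))
  have hτe : τ e = -(σ e' * s' * s) := by simp [τ]
  have hτne : ∀ e'', e'' ≠ e → τ e'' = σ e'' := fun e'' h => by simp [τ, h]
  refine ⟨τ, fun e'' => ?_, flux_eq_zero_of_identify ha hu (fun v => ?_) ?_⟩
  · by_cases k : e'' = e
    · rw [k, hτe]
      rcases hs1 with k1 | k1 <;> rcases hs1' with k2 | k2 <;> rcases h1 e' with k3 | k3 <;>
        rw [k1, k2, k3] <;> decide
    · rw [hτne e'' k]; exact h1 e''
  · rw [← h3 v]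
    refine Finset.sum_congr rfl fun e'' _ => ?_
    by_cases k : e'' = e
    · have : arcOn (ZMod 3) (mapArcs (collapse {a, u} u) g e) {v} = 0 := by
        rcases hj with hj | hj <;> simp [arcOn, mapArcs, collapse, hj]
      rw [k, this, mul_zero, mul_zero]
    · rw [hτne e'' k]
  · rw [flux_eq_sum_cutSet, hcut, Finset.sum_pair hee, hτe, hτne e' hee.symm, ← hs, ← hs']
    rcases hs1 with k1 | k1 <;> rw [k1] <;> ring

/-- Three signs sum to zero modulo 3 only if they are equal: the edges of a 3-cut all cross in the
same direction. -/
lemma eq_of_three_sum {σ s : E → ZMod 3} {C : Finset E} (hC : C.card = 3)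
    (hσ : ∀ e, σ e = 1 ∨ σ e = -1) (hs : ∀ e ∈ C, s e = 1 ∨ s e = -1)
    (h0 : ∑ e ∈ C, σ e * s e = 0) :
    ∃ t : ZMod 3, (t = 1 ∨ t = -1) ∧ ∀ e ∈ C, σ e = t * s e := by
  obtain ⟨a, b, c, hab, hac, hbc, rfl⟩ := Finset.card_eq_three.1 hC
  rw [Finset.sum_insert (by simp [hab, hac]), Finset.sum_pair hbc] at h0
  have ha := hs a (by simp)
  have hb := hs b (by simp)
  have hc := hs c (by simp)
  have key : ∀ x y w p q r : ZMod 3, (x = 1 ∨ x = -1) → (y = 1 ∨ y = -1) → (w = 1 ∨ w = -1) →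
      (p = 1 ∨ p = -1) → (q = 1 ∨ q = -1) → (r = 1 ∨ r = -1) → x * p + (y * q + w * r) = 0 →
      (x * p = 1 ∨ x * p = -1) ∧ x = x * p * p ∧ y = x * p * q ∧ w = x * p * r := by decide
  obtain ⟨k1, k2, k3, k4⟩ := key _ _ _ _ _ _ (hσ a) (hσ b) (hσ c) ha hb hc h0
  refine ⟨σ a * s a, k1, fun e he => ?_⟩
  simp only [Finset.mem_insert, Finset.mem_singleton] at he
  rcases he with rfl | rfl | rfl
  · exact k2
  · exact k3
  · exact k4

/-- Solve with each side contracted. By `eq_of_three_sum` the two solutions agree on the cut up to a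
global sign, so they can be glued. -/
lemma balanced_of_cutDeg_three (hends : ∀ e, (g e).1 ∈ U ∧ (g e).2 ∈ U) (hf : FewOddCuts g)
    (ih : SmallerBalanced E U) {A : Finset V} (hA : A ⊆ U) (h2 : 2 ≤ A.card)
    (h2' : 2 ≤ (U \ A).card) (h3 : cutDeg g A = 3) : Balanced g := by
  obtain ⟨a, ha, a', ha', haa'⟩ := Finset.one_lt_card.1 (show 1 < A.card by omega)
  obtain ⟨w, hw, w', hw', hww'⟩ := Finset.one_lt_card.1 (show 1 < (U \ A).card by omega)
  rw [Finset.mem_sdiff] at hw hw'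
  obtain ⟨σ, hσ1, hσ2⟩ := ih (U.image (collapse A a)) (mapArcs (collapse A a) g)
    (card_image_lt_of_eq (hA ha) (hA ha') haa' (by simp [collapse, ha, ha']))
    (ends_mapArcs hends _) (hf.map _)
  obtain ⟨τ, hτ1, hτ2⟩ := ih (U.image (retract A w)) (mapArcs (retract A w) g)
    (card_image_lt_of_eq hw.1 hw'.1 hww' (by simp [retract, hw.2, hw'.2]))
    (ends_mapArcs hends _) (hf.map _)
  have hσv : ∀ v, v ∉ A → flux g σ {v} = 0 := fun v hv => by
    have := hσ2 v
    rwa [flux_mapArcs, pre_collapse_of_notMem ha hv] at this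
  have hσA : flux g σ A = 0 := by
    have := hσ2 a
    rwa [flux_mapArcs, pre_collapse_self ha] at this
  have hτv : ∀ v ∈ A, flux g τ {v} = 0 := fun v hv => by
    have := hτ2 v
    rwa [flux_mapArcs, pre_retract hw.2 (by simpa using hv)] at this
  have hτA : flux g τ A = 0 := by
    rw [← sum_flux]; exact Finset.sum_eq_zero hτv
  rw [flux_eq_sum_cutSet] at hσA hτA
  have hcard : (cutSet g A).card = 3 := by rw [card_cutSet, h3]
  obtain ⟨s, hs, hs'⟩ := eq_of_three_sum hcard hσ1 (fun e he => arcOn_of_mem_cutSet he) hσA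
  obtain ⟨t, ht, ht'⟩ := eq_of_three_sum hcard hτ1 (fun e he => arcOn_of_mem_cutSet he) hτA
  have hst : ∀ e ∈ cutSet g A, σ e = s * t * τ e := by
    intro e he
    rw [hs' e he, ht' e he]
    rcases ht with h | h <;> rw [h] <;> ring
  let ρ : E → ZMod 3 := fun e => if (g e).1 ∈ A ∧ (g e).2 ∈ A then s * t * τ e else σ e
  refine ⟨ρ, fun e => ?_, fun v => ?_⟩
  · simp only [ρ]
    split_ifs
    · rcases hs with h | h <;> rcases ht with h' | h' <;> rcases hτ1 e with h'' | h'' <;>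
        rw [h, h', h''] <;> decide
    · exact hσ1 e
  · by_cases hv : v ∈ A
    · have : flux g ρ {v} = s * t * flux g τ {v} := by
        unfold flux
        rw [Finset.mul_sum]
        refine Finset.sum_congr rfl fun e _ => ?_
        by_cases h1 : (g e).1 ∈ A <;> by_cases h4 : (g e).2 ∈ A
        · simp [ρ, h1, h4, mul_assoc]
        · have he : e ∈ cutSet g A := by simp [cutSet, crosses, h1, h4]
          simp only [ρ, h1, h4, and_false, if_false]
          rw [hst e he, mul_assoc]
        · have he : e ∈ cutSet g A := by simp [cutSet, crosses, h1, h4]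
          simp only [ρ, h1, h4, false_and, if_false]
          rw [hst e he, mul_assoc]
        · have k1 : (g e).1 ≠ v := fun h => h1 (h ▸ hv)
          have k2 : (g e).2 ≠ v := fun h => h4 (h ▸ hv)
          simp [arcOn, k1, k2]
      rw [this, hτv v hv, mul_zero]
    · rw [← hσv v hv]
      refine Finset.sum_congr rfl fun e _ => ?_
      by_cases h1 : (g e).1 ∈ A ∧ (g e).2 ∈ A
      · have k1 : (g e).1 ≠ v := fun h => hv (h ▸ h1.1)
        have k2 : (g e).2 ≠ v := fun h => hv (h ▸ h1.2)
        simp [arcOn, k1, k2]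
      · simp [ρ, h1]

/-- After the reductions every 3-cut has a single vertex on one side, which serves as `r` in
`balanced_of_three`. -/
lemma balanced_of_smaller (hends : ∀ e, (g e).1 ∈ U ∧ (g e).2 ∈ U) (hf : FewOddCuts g)
    (ih : SmallerBalanced E U) : Balanced g := by
  by_contra hnb
  rcases U.eq_empty_or_nonempty with rfl | hU
  · have : IsEmpty E := ⟨fun e => by simpa using (hends e).1⟩
    exact hnb ⟨1, fun e => Or.inl rfl, fun v => by simp [flux]⟩
  have hc : ThreeConn U g := by
    intro A hA hne hAU
    by_contra hlt
    have h1 := hf.1 A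
    have h0 : cutDeg g A ≠ 0 := fun h => hnb (balanced_of_cutDeg_zero hends hf ih hA hne hAU h)
    have h2 : cutDeg g A ≠ 2 := fun h => hnb (balanced_of_cutDeg_two hends hf ih h)
    omega
  by_cases h3 : ∀ A, cutDeg g A ≠ 3
  · exact hnb (balanced_of_no_three hends hU hc h3 (by have := hf.2; omega))
  · push Not at h3
    obtain ⟨B, hB⟩ := h3
    obtain ⟨A, hA, hA3⟩ : ∃ A ⊆ U, cutDeg g A = 3 :=
      ⟨B ∩ U, Finset.inter_subset_right, by rw [← card_cutSet, cutSet_inter hends, card_cutSet, hB]⟩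
    have hcompl : cutDeg g (U \ A) = 3 := by
      rw [← card_cutSet, cutSet_sdiff hends, card_cutSet, hA3]
    have hempty : cutDeg g ∅ = 0 := by simp [cutDeg, crosses]
    have key : ∀ D ⊆ U, cutDeg g D = 3 → 2 ≤ D.card := by
      intro D hD hD3
      by_contra hlt
      have h1 : D.card = 1 := by
        have : D.card ≠ 0 := fun h => by
          rw [Finset.card_eq_zero.1 h, hempty] at hD3
          omega
        omega
      obtain ⟨r, rfl⟩ := Finset.card_eq_one.1 h1
      exact hnb (balanced_of_three hends hc (hD (by simp)) hD3 hf.2)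
    exact hnb (balanced_of_cutDeg_three hends hf ih hA (key A hA hA3)
      (key _ Finset.sdiff_subset hcompl) hA3)

/-- A bridgeless graph with few cuts of size three and five has a modulo 3-orientation. -/
theorem balanced_of_fewOddCuts (g : E → V × V) (hf : FewOddCuts g) : Balanced g := by
  have key : ∀ (n : ℕ) (U : Finset V) (g : E → V × V), U.card = n →
      (∀ e, (g e).1 ∈ U ∧ (g e).2 ∈ U) → FewOddCuts g → Balanced g := by
    intro n
    induction n using Nat.strong_induction_on with
    | _ n ih =>
      rintro U g rfl hends hf
      exact balanced_of_smaller hends hf fun U' g' hlt => ih _ hlt U' g' rfl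
  exact key _ Finset.univ g rfl (fun e => by simp) hf

end ModThree

namespace ModThree

/-! ### From a modulo 3-orientation to an integer flow -/

variable {V E : Type*} [DecidableEq V] [Fintype V] [Fintype E] [DecidableEq E]
  {g : E → V × V}

lemma flux_update_value {R : Type*} [Ring R] (g : E → V × V) (f : E → R) (e : E) (c : R)
    (A : Finset V) :
    flux g (Function.update f e c) A = flux g f A + (c - f e) * arcOn R (g e) A := by
  unfold flux
  rw [← Finset.add_sum_erase _ _ (Finset.mem_univ e),
    ← Finset.add_sum_erase _ (fun e => f e * arcOn R (g e) A) (Finset.mem_univ e)]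
  have : ∑ x ∈ Finset.univ.erase e, Function.update f e c x * arcOn R (g x) A
      = ∑ x ∈ Finset.univ.erase e, f x * arcOn R (g x) A :=
    Finset.sum_congr rfl fun x hx => by
      rw [Function.update_of_ne (Finset.ne_of_mem_erase hx)]
  rw [this]; simp only [Function.update_self, sub_mul]; abel

/-- All values are `1` or `-2`. -/
def OneOrNegTwo (f : E → ℤ) : Prop := ∀ e, f e = 1 ∨ f e = -2

lemma OneOrNegTwo.update {f : E → ℤ} (h : OneOrNegTwo f) (e : E) {c : ℤ} (hc : c = 1 ∨ c = -2) :
    OneOrNegTwo (Function.update f e c) := by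
  intro e'
  by_cases he : e' = e
  · subst he; simpa using hc
  · simpa [he] using h e'

/-- Three units of excess can be moved from `u` to `w` by changing values inside `R`. -/
def Pushable (g : E → V × V) (f : E → ℤ) (R : Finset V) (u w : V) : Prop :=
  ∃ f', OneOrNegTwo f' ∧
    (∀ v, flux g f' {v} = flux g f {v} - (if v = u then 3 else 0) + (if v = w then 3 else 0)) ∧
    ∀ e, f' e ≠ f e → (g e).1 ∈ R ∧ (g e).2 ∈ R

lemma Pushable.mono {f : E → ℤ} {R S : Finset V} (hRS : R ⊆ S) {u w : V}
    (h : Pushable g f R u w) : Pushable g f S u w := by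
  obtain ⟨f', h1, h2, h3⟩ := h
  exact ⟨f', h1, h2, fun e he => ⟨hRS (h3 e he).1, hRS (h3 e he).2⟩⟩

/-- Earlier changes stay inside `R`, so the edge to the new vertex `w` still has its original value
and can be switched to pass the three units on. -/
lemma Pushable.step {f : E → ℤ} {R : Finset V} {u x w : V} (h : Pushable g f R u x) (hx : x ∈ R)
    (hw : w ∉ R) {e : E} (he : (g e = (x, w) ∧ f e = 1) ∨ (g e = (w, x) ∧ f e = -2)) :
    Pushable g f (insert w R) u w := by
  obtain ⟨f', h1, h2, h3⟩ := h
  have hfe : f' e = f e := by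
    by_contra hne
    have := h3 e hne
    rcases he with he | he <;> rw [he.1] at this
    · exact hw this.2
    · exact hw this.1
  have hoff : ∀ c e', Function.update f' e c e' ≠ f e' →
      (g e').1 ∈ insert w R ∧ (g e').2 ∈ insert w R := by
    intro c e' hne
    by_cases hee : e' = e
    · subst hee
      rcases he with he | he <;> simp [he.1, hx]
    · rw [Function.update_of_ne hee] at hne
      have := h3 e' hne
      simp [this.1, this.2]
  rcases he with ⟨hg, hf⟩ | ⟨hg, hf⟩
  · refine ⟨Function.update f' e (-2), h1.update e (Or.inr rfl), fun v => ?_, hoff _⟩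
    rw [flux_update_value, h2, hfe, hf, hg]
    simp only [arcOn, Finset.mem_singleton, eq_comm (a := x), eq_comm (a := w)]
    split_ifs <;> ring
  · refine ⟨Function.update f' e 1, h1.update e (Or.inl rfl), fun v => ?_, hoff _⟩
    rw [flux_update_value, h2, hfe, hf, hg]
    simp only [arcOn, Finset.mem_singleton, eq_comm (a := x), eq_comm (a := w)]
    split_ifs <;> ring

/-- Take `R` of maximal size: an edge leaving `R` that could still be switched would enlarge it by
`Pushable.step`. -/
lemma exists_closed_pushable {f : E → ℤ} (hf : OneOrNegTwo f) (u : V) :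
    ∃ R : Finset V, u ∈ R ∧ (∀ w ∈ R, Pushable g f R u w) ∧
      ∀ e, ((g e).1 ∈ R → (g e).2 ∉ R → f e = -2) ∧ ((g e).2 ∈ R → (g e).1 ∉ R → f e = 1) := by
  classical
  obtain ⟨R, hR, hmax⟩ := Finset.exists_max_image
    (Finset.univ.filter fun R : Finset V => u ∈ R ∧ ∀ w ∈ R, Pushable g f R u w) Finset.card
    ⟨{u}, by
      simp only [Finset.mem_filter, Finset.mem_univ, true_and, Finset.mem_singleton]
      intro w hw
      rw [hw]
      exact ⟨f, hf, fun v => by ring, fun e he => absurd rfl he⟩⟩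
  simp only [Finset.mem_filter, Finset.mem_univ, true_and] at hR hmax
  have hstep : ∀ x w e, x ∈ R → w ∉ R →
      ¬ ((g e = (x, w) ∧ f e = 1) ∨ (g e = (w, x) ∧ f e = -2)) := by
    intro x w e hx hw he
    have := hmax (insert w R) ⟨Finset.mem_insert_of_mem hR.1, fun v hv => by
      rcases Finset.mem_insert.1 hv with rfl | hv
      · exact (hR.2 x hx).step hx hw he
      · exact (hR.2 v hv).mono (Finset.subset_insert w R)⟩
    rw [Finset.card_insert_of_notMem hw] at this
    omega
  refine ⟨R, hR.1, hR.2, fun e => ⟨fun h1 h2 => ?_, fun h1 h2 => ?_⟩⟩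
  · exact (hf e).resolve_left fun h => hstep _ _ e h1 h2 (Or.inl ⟨rfl, h⟩)
  · exact (hf e).resolve_right fun h => hstep _ _ e h1 h2 (Or.inr ⟨rfl, h⟩)

lemma three_dvd_flux (h3 : ∀ v, (3 : ℤ) ∣ flux g 1 {v}) {f : E → ℤ} (hf : OneOrNegTwo f) (v : V) :
    (3 : ℤ) ∣ flux g f {v} := by
  have : flux g f {v} = flux g 1 {v} + ∑ e, (f e - 1) * arcOn ℤ (g e) {v} := by
    unfold flux
    rw [← Finset.sum_add_distrib]
    exact Finset.sum_congr rfl fun e _ => by simp only [Pi.one_apply]; ring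
  rw [this]
  refine dvd_add (h3 v) (Finset.dvd_sum fun e _ => Dvd.dvd.mul_right ?_ _)
  rcases hf e with h | h <;> rw [h] <;> norm_num

/-- If the closed set `R` around a surplus vertex had no deficit, its outflow would be positive; yet
leaving edges carry -2 and entering ones 1. Moving three units from surplus to deficit does not
overshoot, because all outflows are multiples of 3. -/
lemma exists_less_imbalance (h3 : ∀ v, (3 : ℤ) ∣ flux g 1 {v}) {f : E → ℤ} (hf : OneOrNegTwo f)
    (hne : ∃ v, flux g f {v} ≠ 0) :
    ∃ f', OneOrNegTwo f' ∧ ∑ v, (flux g f' {v}).natAbs < ∑ v, (flux g f {v}).natAbs := by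
  obtain ⟨u, hu⟩ : ∃ u, 0 < flux g f {u} := by
    by_contra! hle
    obtain ⟨v, hv⟩ := hne
    have h0 : ∑ v, flux g f {v} = 0 := by rw [sum_flux, flux_univ]
    exact hv ((Finset.sum_eq_zero_iff_of_nonpos fun v _ => hle v).1 h0 v (Finset.mem_univ v))
  obtain ⟨R, huR, hpush, hclosed⟩ := exists_closed_pushable (g := g) hf u
  obtain ⟨w, hwR, hw⟩ : ∃ w ∈ R, flux g f {w} < 0 := by
    by_contra! hge
    have hpos : 0 < ∑ v ∈ R, flux g f {v} := Finset.sum_pos' hge ⟨u, huR, hu⟩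
    rw [sum_flux] at hpos
    refine absurd hpos (not_lt.2 (Finset.sum_nonpos fun e _ => ?_))
    by_cases h1 : (g e).1 ∈ R <;> by_cases h2 : (g e).2 ∈ R
    · simp [arcOn, h1, h2]
    · simp [arcOn, h1, h2, (hclosed e).1 h1 h2]
    · simp [arcOn, h1, h2, (hclosed e).2 h2 h1]
    · simp [arcOn, h1, h2]
  obtain ⟨f', hf', hflux, -⟩ := hpush w hwR
  have hdu := three_dvd_flux h3 hf u
  have hdw := three_dvd_flux h3 hf w
  have huw : u ≠ w := by rintro rfl; omega
  refine ⟨f', hf', Finset.sum_lt_sum (fun v _ => ?_) ⟨u, Finset.mem_univ u, ?_⟩⟩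
  · rw [hflux]
    by_cases k1 : v = u
    · subst k1; simp only [if_true, huw, if_false]; omega
    · by_cases k2 : v = w
      · subst k2; simp only [if_true, k1, if_false]; omega
      · simp [k1, k2]
  · rw [hflux]; simp only [if_true, huw, if_false]; omega

/-- A modulo 3-orientation yields an integer flow with values `1` and `-2`. -/
theorem exists_integer_flow (h3 : ∀ v, (3 : ℤ) ∣ flux g 1 {v}) :
    ∃ f : E → ℤ, OneOrNegTwo f ∧ ∀ v, flux g f {v} = 0 := by
  have key : ∀ (n : ℕ) (f : E → ℤ), OneOrNegTwo f → ∑ v, (flux g f {v}).natAbs = n →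
      ∃ f : E → ℤ, OneOrNegTwo f ∧ ∀ v, flux g f {v} = 0 := by
    intro n
    induction n using Nat.strong_induction_on with
    | _ n ih =>
      rintro f hf rfl
      by_cases hne : ∃ v, flux g f {v} ≠ 0
      · obtain ⟨f', hf', hlt⟩ := exists_less_imbalance h3 hf hne
        exact ih _ hlt f' hf' rfl
      · push Not at hne
        exact ⟨f, hf, hne⟩
  exact key _ 1 (fun _ => Or.inl rfl) rfl

end ModThree

namespace ModThree

/-! ### Translation to and from `Graph` -/

open Classical in
lemma image_cutSet {α β : Type*} {G : Graph α β} [Fintype V(G)] [Fintype E(G)]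
    {g : E(G) → V(G) × V(G)} (hg : ∀ e : E(G), G.IsLink (e : β) (g e).1 (g e).2) (A : Finset V(G)) :
    G.edgeCut (Subtype.val '' (A : Set V(G))) = Subtype.val '' (cutSet g A : Set E(G)) := by
  ext b
  simp only [Graph.edgeCut, Graph.edgesBetween, Set.mem_ofPred_eq, Set.mem_image, Finset.mem_coe,
    Set.mem_sdiff, cutSet, Finset.mem_filter, Finset.mem_univ, true_and]
  constructor
  · rintro ⟨_, ⟨x, hx, rfl⟩, y, ⟨hy, hyA⟩, hl⟩
    refine ⟨⟨b, hl.edge_mem⟩, ?_, rfl⟩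
    have hyA' : (⟨y, hy⟩ : V(G)) ∉ A := fun h => hyA ⟨_, h, rfl⟩
    rcases (hg ⟨b, hl.edge_mem⟩).eq_and_eq_or_eq_and_eq hl with ⟨h1, h2⟩ | ⟨h1, h2⟩
    · have k1 : (g ⟨b, hl.edge_mem⟩).1 = x := Subtype.ext h1
      have k2 : (g ⟨b, hl.edge_mem⟩).2 = ⟨y, hy⟩ := Subtype.ext h2
      simp [crosses, k1, k2, hx, hyA']
    · have k1 : (g ⟨b, hl.edge_mem⟩).1 = ⟨y, hy⟩ := Subtype.ext h1
      have k2 : (g ⟨b, hl.edge_mem⟩).2 = x := Subtype.ext h2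
      simp [crosses, k1, k2, hx, hyA']
  · rintro ⟨e, he, rfl⟩
    unfold crosses at he
    by_cases k1 : (g e).1 ∈ A <;> by_cases k2 : (g e).2 ∈ A
    · simp [k1, k2] at he
    · exact ⟨_, ⟨_, k1, rfl⟩, _, ⟨(g e).2.2, fun ⟨w, hw, hw'⟩ => k2 (Subtype.ext hw' ▸ hw)⟩, hg e⟩
    · exact ⟨_, ⟨_, k2, rfl⟩, _, ⟨(g e).1.2, fun ⟨w, hw, hw'⟩ => k1 (Subtype.ext hw' ▸ hw)⟩,
        (hg e).symm⟩
    · simp [k1, k2] at he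

open Classical in
lemma card_cuts_le {α β : Type*} {G : Graph α β} [Fintype V(G)] [Fintype E(G)]
    {g : E(G) → V(G) × V(G)} (hg : ∀ e : E(G), G.IsLink (e : β) (g e).1 (g e).2) (k : ℕ) :
    ((cuts g k).card : ℕ∞) ≤ (G.kEdgeCuts k).encard := by
  have hinj : Function.Injective fun C : Finset E(G) => Subtype.val '' (C : Set E(G)) :=
    (Set.image_injective.2 Subtype.val_injective).comp Finset.coe_injective
  rw [← Set.encard_coe_eq_coe_finsetCard, ← hinj.encard_image]
  refine Set.encard_le_encard ?_
  rintro _ ⟨C, hC, rfl⟩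
  obtain ⟨h1, A, rfl⟩ := mem_cuts.1 (Finset.mem_coe.1 hC)
  refine ⟨Subtype.val '' (A : Set V(G)), ?_, (image_cutSet hg A).symm, ?_⟩
  · rintro _ ⟨x, -, rfl⟩; exact x.2
  · change (Subtype.val '' ((cutSet g A : Finset E(G)) : Set E(G))).encard = k
    rw [Subtype.val_injective.encard_image, Set.encard_coe_eq_coe_finsetCard, h1]

open Classical in
lemma fewOddCuts_of_graph {α β : Type*} {G : Graph α β} [Fintype V(G)] [Fintype E(G)]
    {g : E(G) → V(G) × V(G)} (hg : ∀ e : E(G), G.IsLink (e : β) (g e).1 (g e).2)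
    (hb : G.Bridgeless)
    (hcuts : 2 * (G.kEdgeCuts 3).encard + (G.kEdgeCuts 5).encard ≤ 7) : FewOddCuts g := by
  refine ⟨fun A hA => ?_, ?_⟩
  · rw [← card_cutSet, Finset.card_eq_one] at hA
    obtain ⟨e, he⟩ := hA
    refine hb e ⟨Subtype.val '' (A : Set V(G)), ?_, ?_⟩
    · rintro _ ⟨x, -, rfl⟩; exact x.2
    · rw [image_cutSet hg, he]; simp
  · have h3 := card_cuts_le hg 3
    have h5 := card_cuts_le hg 5
    have : (2 * ((cuts g 3).card : ℕ∞) + ((cuts g 5).card : ℕ∞)) ≤ 7 :=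
      le_trans (add_le_add (mul_le_mul_right h3 2) h5) hcuts
    exact_mod_cast this

open Classical in
lemma flux_eq_outDegree_sub {α β : Type*} {G : Graph α β} [Fintype E(G)] (D : G.Orientation)
    {g : E(G) → V(G) × V(G)} (h1 : ∀ e, D.tail e = (g e).1) (h2 : ∀ e, D.head e = (g e).2)
    (x : V(G)) : flux g (1 : E(G) → ℤ) {x} = (D.outDegree x : ℤ) - (D.inDegree x : ℤ) := by
  have k1 : D.outArcs x = ((Finset.univ.filter fun e => (g e).1 = x : Finset E(G)) : Set E(G)) := by
    ext e; simp [Graph.Orientation.outArcs, h1, Subtype.ext_iff]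
  have k2 : D.inArcs x = ((Finset.univ.filter fun e => (g e).2 = x : Finset E(G)) : Set E(G)) := by
    ext e; simp [Graph.Orientation.inArcs, h2, Subtype.ext_iff]
  rw [Graph.Orientation.outDegree, Graph.Orientation.inDegree, k1, k2, Set.ncard_coe_finset,
    Set.ncard_coe_finset, Finset.card_filter, Finset.card_filter]
  simp [flux, arcOn]

open Classical in
lemma flux_eq_finsum_sub {α β : Type*} {G : Graph α β} [Fintype E(G)] (D : G.Orientation)
    {g : E(G) → V(G) × V(G)} (h1 : ∀ e, D.tail e = (g e).1) (h2 : ∀ e, D.head e = (g e).2)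
    (f : E(G) → ℤ) (x : V(G)) :
    flux g f {x} = ∑ᶠ e ∈ D.outArcs x, f e - ∑ᶠ e ∈ D.inArcs x, f e := by
  rw [finsum_mem_def, finsum_mem_def, finsum_eq_sum_of_fintype, finsum_eq_sum_of_fintype,
    ← Finset.sum_sub_distrib]
  refine Finset.sum_congr rfl fun e _ => ?_
  simp only [Set.indicator_apply, Graph.Orientation.outArcs, Graph.Orientation.inArcs,
    Set.mem_ofPred_eq, h1, h2, arcOn, Finset.mem_singleton, Subtype.ext_iff]
  split_ifs <;> simp

open Classical in
lemma exists_dvd_orientation {α β : Type*} {G : Graph α β} [Fintype V(G)] [Fintype E(G)]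
    (hb : G.Bridgeless)
    (hcuts : 2 * (G.kEdgeCuts 3).encard + (G.kEdgeCuts 5).encard ≤ 7) :
    ∃ g : E(G) → V(G) × V(G), (∀ e : E(G), G.IsLink (e : β) (g e).1 (g e).2) ∧
      ∀ x, (3 : ℤ) ∣ flux g 1 {x} := by
  have hex : ∀ e : E(G), ∃ p : V(G) × V(G), G.IsLink (e : β) p.1 p.2 := fun e => by
    obtain ⟨x, y, hl⟩ := G.exists_isLink_of_mem_edgeSet e.2
    exact ⟨(⟨x, hl.left_mem⟩, ⟨y, hl.right_mem⟩), hl⟩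
  choose g hg using hex
  obtain ⟨σ, h1, h2⟩ := balanced_of_fewOddCuts g (fewOddCuts_of_graph hg hb hcuts)
  refine ⟨fun e => if σ e = 1 then g e else (g e).swap, fun e => ?_, fun x => ?_⟩
  · dsimp only
    split_ifs
    · exact hg e
    · exact (hg e).symm
  · have : ((flux (fun e => if σ e = 1 then g e else (g e).swap) (1 : E(G) → ℤ) {x} : ℤ) : ZMod 3)
        = 0 := by
      -- Swapping an arc negates its contribution, just as the sign -1 does.
      rw [← h2 x, ← eq_intCast (Int.castRingHom (ZMod 3)), map_flux]
      refine Finset.sum_congr rfl fun e _ => ?_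
      by_cases h : σ e = 1
      · simp [h]
      · simp only [h, if_false]
        rw [(h1 e).resolve_left h, arcOn_swap]; simp
    exact (ZMod.intCast_zmod_eq_zero_iff_dvd _ 3).1 this

end ModThree

theorem theorem1p12 {α β : Type*} (G : Graph α β)
    (hV : V(G).Finite) (hE : E(G).Finite)
    (hloopless : G.Loopless) (hbridgeless : G.Bridgeless)
    (hcuts : 2 * (G.kEdgeCuts 3).encard + (G.kEdgeCuts 5).encard ≤ 7) :
    (∃ D : G.Orientation, D.IsModuloThree) ∧
      ∃ (D : G.Orientation) (f : E(G) → ℤ), D.IsNowhereZeroThreeFlow f := by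
  classical
  have := hV.fintype
  have := hE.fintype
  obtain ⟨g, hg, h3⟩ := ModThree.exists_dvd_orientation hbridgeless hcuts
  let D : G.Orientation := ⟨fun e => (g e).1, fun e => (g e).2, hg⟩
  refine ⟨⟨D, fun x hx => ?_⟩, D, ?_⟩
  · have h := h3 ⟨x, hx⟩
    rw [ModThree.flux_eq_outDegree_sub D (fun _ => rfl) (fun _ => rfl)] at h
    exact Int.modEq_zero_iff_dvd.2 h
  · obtain ⟨f, hf, hflux⟩ := ModThree.exists_integer_flow h3
    refine ⟨f, fun e => ?_, fun x hx => ?_⟩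
    · rcases hf e with h | h <;> simp [h]
    · have h := hflux ⟨x, hx⟩
      rw [ModThree.flux_eq_finsum_sub D (fun _ => rfl) (fun _ => rfl)] at h
      exact sub_eq_zero.1 h
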